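/- \textbf{Setting.} A hybrid time domain is a set $E\subset\mathbb R_{\ge0}\times\mathbb Z_{\ge0}$ such that for each $(T,J)\in E$ there are $0=t_0\le t_1\le\dots\le t_{J+1}=T$ with $E\cap([0,T]\times\{0,\dots,J\})=\bigcup_{j=0}^{J}[t_j,t_{j+1}]\times\{j\}$; hybrid time domains starting at $(t_o,j_o)$ instead of $(0,0)$ are defined in the same way. Let $I^j_E=\{t:(t,j)\in E\}$. A function on $E$ is a hybrid arc if it is locally absolutely continuous in $t$ on each $I^j_E$. Fix a hybrid time domain $D$ and functions $A,B:D\to\mathbb R^{m\times m}$; write $I^j=I^j_D$. For $\nu:D\to\mathbb R^m$ let $\mathcal H'_\nu$ be the system $$\dot\zeta=-A(t,j)\zeta+\nu(t,j)\ \ (t\in\mathrm{int}(I^j)),\qquad \zeta^+=[I_m-B(t,j)]\zeta+\nu(t,j)\ \ ((t,j),(t,j+1)\in D).$$ A solution starting at $(t_o,j_o)\in D$ from $\zeta_o\in\mathbb R^m$ is a hybrid arc $\zeta$ whose domain is a hybrid time domain $\mathrm{dom}\,\zeta\subset D$ starting at $(t_o,j_o)$, with $\zeta(t_o,j_o)=\zeta_o$,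 that satisfies the differential equation for almost all $t\in\mathrm{int}\{t:(t,j)\in\mathrm{dom}\,\zeta\}$, for each $j$, and $\zeta(t,j+1)=[I_m-B(t,j)]\zeta(t,j)+\nu(t,j)$ whenever $(t,j),(t,j+1)\in\mathrm{dom}\,\zeta$. Let $(t,j)\mapsto\mathcal M((t,j),(t_o,j_o))$ be the transition matrix of $\mathcal H'_0$, i.e. the matrix solution, on the part of $D$ at or after $(t_o,j_o)$, of $\dot{\mathcal M}=-A\mathcal M$, $\mathcal M^+=(I_m-B)\mathcal M$, equal to $I_m$ at $(t_o,j_o)$. For $K>0$ let $E_{t_o,j_o,K}=\bigcup_{i=j_o}^{k}[t_i,t_{i+1}]\times\{i\}\subset D$, with $t_{j_o}=t_o$, be the shortest hybrid time domain contained in $D$, starting at $(t_o,j_o)$, whose length $(t_{k+1}-t_o)+(k-j_o)$ is at least $K$; and let $\int_{E_{t_o,j_o,K}}\phi\,d(s,i):=\sum_{i=j_o}^{k}\int_{t_i}^{t_{i+1}}\phi(s,i)\,ds+\sum_{i=j_o}^{k-1}\phi(t_{i+1},i)$. Matrix inequalities are in the Loewner order, and $|\cdot|$ is the Euclidean norm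 and the matrix norm it induces. \textbf{Assumptions.} (1) There are a hybrid arc $P:D\to\mathbb R^{m\times m}$ with symmetric values, constants $p_1,p_2>0$ with $p_1I_m\le P(t,j)\le p_2I_m$ on $D$, and functions $Q_c,Q_d$ from $D$ to the symmetric positive semidefinite $m\times m$ matrices, such that, for each $j$ and almost all $t\in\mathrm{int}(I^j)$, $\dot P-A^\top P-PA\le-Q_c$ at $(t,j)$, and, whenever $(t,j),(t,j+1)\in D$, $[I_m-B(t,j)]^\top P(t,j+1)[I_m-B(t,j)]-P(t,j)\le-Q_d(t,j)$. (2) $|A|\le\bar A$ and $|B|\le\bar B$ on $D$ for some constants $\bar A,\bar B>0$. (3) $(A,B)$ is hybrid uniformly observable (HUO) with respect to $Q_c,Q_d$: there are $K,\mu>0$ such that, for each $(t_o,j_o)\in D$, the set $E_{t_o,j_o,K}$ exists and $$\int_{E_{t_o,j_o,K}}\mathcal M((s,i),(t_o,j_o))^\top\Phi(s,i)\mathcal M((s,i),(t_o,j_o))\,d(s,i)\ge\mu I_m,$$ where $\Phi(t,j)=Q_c(t,j)$ if $t\in\mathrm{int}(I^j)$ and $\Phi(t,j)=Q_d(t,j)$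 otherwise. \textbf{Theorem (HUO implies UES and ISS), \label{HUO=>UES}.} Under (1)--(3): (i) the origin is uniformly exponentially stable for $\mathcal H'_0$: there are $\kappa,\lambda>0$ such that every solution $\zeta$ of $\mathcal H'_0$, starting from any $\zeta_o\in\mathbb R^m$ at any $(t_o,j_o)\in D$, satisfies $|\zeta(t,j)|\le\kappa|\zeta_o|e^{-\lambda(t+j-t_o-j_o)}$ for all $(t,j)\in\mathrm{dom}\,\zeta$; (ii) $\mathcal H'_\nu$ is input-to-state stable with respect to $\nu$: there are $\alpha$ of class $\mathcal K_\infty$ and $\beta$ of class $\mathcal{KL}$ such that, for every $\nu:D\to\mathbb R^m$, every solution $\zeta$ of $\mathcal H'_\nu$, starting from any $\zeta_o\in\mathbb R^m$ at any $(t_o,j_o)\in D$, and every $(t,j)\in\mathrm{dom}\,\zeta$ for which the supremum below is finite, $$|\zeta(t,j)|\le\beta(|\zeta_o|,t+j-t_o-j_o)+\alpha\big(\sup\{|\nu(s,i)|:(s,i)\in\mathrm{dom}\,\zeta,\ (s,i)\text{ strictly before }(t,j)\}\big),$$ where the supremum over the empty set is $0$. -/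

import Mathlib

open Set Filter Topology MeasureTheory
open scoped Matrix MatrixOrder Matrix.Norms.L2Operator

noncomputable section

namespace HybridLTV

/-- The slice `I^j = {t : (t, j) ∈ E}` of a set of hybrid times. -/
def slice (E : Set (ℝ × ℕ)) (j : ℕ) : Set ℝ := {t | (t, j) ∈ E}

/-- The union `⋃_{i=j}^{m} [τ i, τ (i+1)] × {i}`. -/
def chain (τ : ℕ → ℝ) (j m : ℕ) : Set (ℝ × ℕ) :=
  {p | j ≤ p.2 ∧ p.2 ≤ m ∧ τ p.2 ≤ p.1 ∧ p.1 ≤ τ (p.2 + 1)}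

/-- Hybrid time domains with initial hybrid time `(t₀, j₀)`. -/
def IsHybridTimeDomain (t₀ : ℝ) (j₀ : ℕ) (E : Set (ℝ × ℕ)) : Prop :=
  E ⊆ Ici t₀ ×ˢ Ici j₀ ∧
  ∀ T J, (T, J) ∈ E → ∃ τ : ℕ → ℝ, τ j₀ = t₀ ∧ τ (J + 1) = T ∧
    (∀ i ∈ Icc j₀ J, τ i ≤ τ (i + 1)) ∧ E ∩ (Icc t₀ T ×ˢ Icc j₀ J) = chain τ j₀ J

/-- The points of `E` at or after `(t, j)`, i.e. the part of `E` of infinite horizon that starts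
at `(t, j)`. -/
def forward (E : Set (ℝ × ℕ)) (t : ℝ) (j : ℕ) : Set (ℝ × ℕ) := {p ∈ E | t ≤ p.1 ∧ j ≤ p.2}

/-- A signal on the hybrid time domain `E` is a hybrid arc if each `φ(·, j)` is absolutely
continuous on every compact subinterval of `I^j`. -/
def IsHybridArc {X : Type*} [NormedAddCommGroup X] (E : Set (ℝ × ℕ)) (φ : ℝ → ℕ → X) : Prop :=
  ∀ (j : ℕ) (a b : ℝ), a ≤ b → Icc a b ⊆ slice E j →
    AbsolutelyContinuousOnInterval (fun t => φ t j) a b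

/-- `ζ`, with domain `E ⊆ D`, is a solution starting at the hybrid time `(t₀, j₀)` of
`ζ' = F(ζ, t, j)` for `t` in the interior of `I^j`, and `ζ⁺ = G(ζ, t, j)` whenever
`(t, j), (t, j+1)` both belong to the domain. -/
structure IsSolution {X : Type*} [NormedAddCommGroup X] [NormedSpace ℝ X] (D : Set (ℝ × ℕ))
    (F G : X → ℝ → ℕ → X) (t₀ : ℝ) (j₀ : ℕ) (E : Set (ℝ × ℕ)) (ζ : ℝ → ℕ → X) : Prop where
  dom : IsHybridTimeDomain t₀ j₀ E
  sub : E ⊆ D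
  start : (t₀, j₀) ∈ E
  arc : IsHybridArc E ζ
  flow : ∀ j, ∀ᵐ t : ℝ, t ∈ interior (slice E j) →
    HasDerivAt (fun s => ζ s j) (F (ζ t j) t j) t
  jump : ∀ t j, (t, j) ∈ E → (t, j + 1) ∈ E → ζ t (j + 1) = G (ζ t j) t j

variable {n : ℕ}

/-- Flow map `-A(t,j) ζ + ν(t,j)`. -/
def flowMap (A : ℝ → ℕ → Matrix (Fin n) (Fin n) ℝ) (ν : ℝ → ℕ → EuclideanSpace ℝ (Fin n))
    (ζ : EuclideanSpace ℝ (Fin n)) (t : ℝ) (j : ℕ) : EuclideanSpace ℝ (Fin n) :=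
  -(Matrix.toEuclideanCLM (𝕜 := ℝ) (A t j) ζ) + ν t j

/-- Jump map `[I - B(t,j)] ζ + ν(t,j)`. -/
def jumpMap (B : ℝ → ℕ → Matrix (Fin n) (Fin n) ℝ) (ν : ℝ → ℕ → EuclideanSpace ℝ (Fin n))
    (ζ : EuclideanSpace ℝ (Fin n)) (t : ℝ) (j : ℕ) : EuclideanSpace ℝ (Fin n) :=
  Matrix.toEuclideanCLM (𝕜 := ℝ) (1 - B t j) ζ + ν t j

/-- Solutions of the linear hybrid system with perturbation `ν`, starting from `ζ t₀ j₀` at the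
hybrid time `(t₀, j₀)`. -/
def IsLinearSolution (D : Set (ℝ × ℕ)) (A B : ℝ → ℕ → Matrix (Fin n) (Fin n) ℝ)
    (ν : ℝ → ℕ → EuclideanSpace ℝ (Fin n)) (t₀ : ℝ) (j₀ : ℕ) (E : Set (ℝ × ℕ))
    (ζ : ℝ → ℕ → EuclideanSpace ℝ (Fin n)) : Prop :=
  IsSolution D (flowMap A ν) (jumpMap B ν) t₀ j₀ E ζ

/-- `M` solves the matrix system `M' = -A M`, `M⁺ = (I - B) M`, `M(t₀, j₀) = I` on all of the part
of `D` at or after `(t₀, j₀)`. -/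
def IsTransitionMatrix (D : Set (ℝ × ℕ)) (A B : ℝ → ℕ → Matrix (Fin n) (Fin n) ℝ)
    (t₀ : ℝ) (j₀ : ℕ) (M : ℝ → ℕ → Matrix (Fin n) (Fin n) ℝ) : Prop :=
  IsSolution D (fun X t j => -(A t j * X)) (fun X t j => (1 - B t j) * X) t₀ j₀
    (forward D t₀ j₀) M ∧ M t₀ j₀ = 1

open Classical in
/-- The hybrid transition matrix `(t, j) ↦ 𝓜((t,j),(t₀,j₀))`; its values matter only at the points
of `D` at or after `(t₀, j₀)`, where the defining system determines them. -/
def transitionMatrix (D : Set (ℝ × ℕ)) (A B : ℝ → ℕ → Matrix (Fin n) (Fin n) ℝ)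
    (t₀ : ℝ) (j₀ : ℕ) : ℝ → ℕ → Matrix (Fin n) (Fin n) ℝ :=
  if h : ∃ M, IsTransitionMatrix D A B t₀ j₀ M then h.choose else 0

/-- `chain τ j m` is the shortest hybrid time domain contained in `D`, starting from `(t, j)`, of
length at least `K`. Its last point is `(τ (m+1), m)`. -/
structure IsWindow (D : Set (ℝ × ℕ)) (t : ℝ) (j : ℕ) (K : ℝ) (m : ℕ) (τ : ℕ → ℝ) : Prop where
  start : τ j = t
  le : j ≤ m
  mono : ∀ i ∈ Icc j m, τ i ≤ τ (i + 1)
  sub : chain τ j m ⊆ D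
  length : K ≤ (τ (m + 1) - t) + ((m : ℝ) - j)
  shortest : ∀ s i, (s, i) ∈ D → t ≤ s → j ≤ i → K ≤ (s - t) + ((i : ℝ) - j) →
    (τ (m + 1) - t) + ((m : ℝ) - j) ≤ (s - t) + ((i : ℝ) - j)

/-- The hybrid integral over `chain τ j m`. -/
def hybridIntegral {X : Type*} [NormedAddCommGroup X] [NormedSpace ℝ X]
    (τ : ℕ → ℝ) (j m : ℕ) (φ : ℝ → ℕ → X) : X :=
  (∑ i ∈ Finset.Icc j m, ∫ s in (τ i)..(τ (i + 1)), φ s i) +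
    ∑ i ∈ Finset.Ico j m, φ (τ (i + 1)) i

/-- Lyapunov (non-strict) inequalities, in the Loewner order, for the hybrid arc `P`. -/
def LyapunovInequalities (D : Set (ℝ × ℕ))
    (A B P Qc Qd : ℝ → ℕ → Matrix (Fin n) (Fin n) ℝ) : Prop :=
  IsHybridArc D P ∧
  (∀ t j, (t, j) ∈ D → (P t j).IsSymm) ∧
  (∃ p₁ p₂ : ℝ, 0 < p₁ ∧ 0 < p₂ ∧ ∀ t j, (t, j) ∈ D →
    p₁ • (1 : Matrix (Fin n) (Fin n) ℝ) ≤ P t j ∧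
    P t j ≤ p₂ • (1 : Matrix (Fin n) (Fin n) ℝ)) ∧
  (∀ t j, (t, j) ∈ D → (Qc t j).PosSemidef ∧ (Qd t j).PosSemidef) ∧
  (∀ j, ∀ᵐ t : ℝ, t ∈ interior (slice D j) →
    ∃ P' : Matrix (Fin n) (Fin n) ℝ, HasDerivAt (fun s => P s j) P' t ∧
      P' - (A t j)ᵀ * P t j - P t j * A t j ≤ -Qc t j) ∧
  (∀ t j, (t, j) ∈ D → (t, j + 1) ∈ D →
    (1 - B t j)ᵀ * P t (j + 1) * (1 - B t j) - P t j ≤ -Qd t j)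

/-- Uniform boundedness of `A` and `B` on `D`; `‖·‖` is the norm induced by the Euclidean one. -/
def UniformlyBounded (D : Set (ℝ × ℕ)) (A B : ℝ → ℕ → Matrix (Fin n) (Fin n) ℝ) : Prop :=
  ∃ Abar Bbar : ℝ, 0 < Abar ∧ 0 < Bbar ∧
    ∀ t j, (t, j) ∈ D → ‖A t j‖ ≤ Abar ∧ ‖B t j‖ ≤ Bbar

open Classical in
/-- `Φ(t,j) = Qc(t,j)` if `t` is interior to `I^j`, and `Qd(t,j)` otherwise. -/
def Phi (D : Set (ℝ × ℕ)) (Qc Qd : ℝ → ℕ → Matrix (Fin n) (Fin n) ℝ) (t : ℝ) (j : ℕ) :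
    Matrix (Fin n) (Fin n) ℝ :=
  if t ∈ interior (slice D j) then Qc t j else Qd t j

/-- Hybrid uniform observability of the pair `(A, B)` with the output weights `Qc, Qd`. -/
def HUO (D : Set (ℝ × ℕ)) (A B Qc Qd : ℝ → ℕ → Matrix (Fin n) (Fin n) ℝ) : Prop :=
  ∃ K μ : ℝ, 0 < K ∧ 0 < μ ∧ ∀ t₀ j₀, (t₀, j₀) ∈ D →
    ∃ (m : ℕ) (τ : ℕ → ℝ), IsWindow D t₀ j₀ K m τ ∧
      μ • (1 : Matrix (Fin n) (Fin n) ℝ) ≤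
        hybridIntegral τ j₀ m (fun s i =>
          (transitionMatrix D A B t₀ j₀ s i)ᵀ * Phi D Qc Qd s i *
            transitionMatrix D A B t₀ j₀ s i)

/-- Uniform exponential stability of the origin for the unperturbed system. -/
def UES (D : Set (ℝ × ℕ)) (A B : ℝ → ℕ → Matrix (Fin n) (Fin n) ℝ) : Prop :=
  ∃ κ lam : ℝ, 0 < κ ∧ 0 < lam ∧
    ∀ t₀ j₀ E ζ, IsLinearSolution D A B (fun _ _ => 0) t₀ j₀ E ζ →
      ∀ t j, (t, j) ∈ E →
        ‖ζ t j‖ ≤ κ * ‖ζ t₀ j₀‖ * Real.exp (-lam * (t + j - t₀ - j₀))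

/-- Class `𝓚` functions on `[0, ∞)`. -/
def IsClassK (α : ℝ → ℝ) : Prop :=
  ContinuousOn α (Ici 0) ∧ StrictMonoOn α (Ici 0) ∧ α 0 = 0

/-- Class `𝓚∞` functions on `[0, ∞)`. -/
def IsClassKInfty (α : ℝ → ℝ) : Prop := IsClassK α ∧ Tendsto α atTop atTop

/-- Class `𝓚𝓛` functions on `[0, ∞) × [0, ∞)`. -/
def IsClassKL (β : ℝ → ℝ → ℝ) : Prop :=
  ContinuousOn (fun p : ℝ × ℝ => β p.1 p.2) (Ici 0 ×ˢ Ici 0) ∧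
  (∀ s, 0 ≤ s → IsClassK (fun r => β r s)) ∧
  ∀ r, 0 ≤ r → AntitoneOn (β r) (Ici 0) ∧ Tendsto (β r) atTop (𝓝 0)

/-- The magnitudes of `ν` over the points of `E` strictly before `(t, j)`. -/
def pastMagnitudes (E : Set (ℝ × ℕ)) (ν : ℝ → ℕ → EuclideanSpace ℝ (Fin n)) (t : ℝ) (j : ℕ) :
    Set ℝ :=
  (fun p : ℝ × ℕ => ‖ν p.1 p.2‖) '' (E \ forward E t j)

/-- Input-to-state stability with respect to `ν`. Where the supremum of the past magnitudes is
infinite the estimate claims nothing; over no past points the supremum is `0`. -/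
def ISS (D : Set (ℝ × ℕ)) (A B : ℝ → ℕ → Matrix (Fin n) (Fin n) ℝ) : Prop :=
  ∃ (α : ℝ → ℝ) (β : ℝ → ℝ → ℝ), IsClassKInfty α ∧ IsClassKL β ∧
    ∀ (ν : ℝ → ℕ → EuclideanSpace ℝ (Fin n)) t₀ j₀ E ζ, IsLinearSolution D A B ν t₀ j₀ E ζ →
      ∀ t j, (t, j) ∈ E → BddAbove (pastMagnitudes E ν t j) →
        ‖ζ t j‖ ≤ β ‖ζ t₀ j₀‖ (t + j - t₀ - j₀) + α (sSup (pastMagnitudes E ν t j))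

end HybridLTV

end

/-!
# Hybrid uniform observability implies exponential and input-to-state stability

Write `‖x‖_P = √(xᵀ P x)`. Integrating the Lyapunov inequality along flows and applying it at jumps
shows that `‖ζ‖_P` grows along any solution by at most `√p₂ · sup |ν|` per unit of hybrid length
(`HasLyapunovBounds.wnorm_le`); in particular it never grows when `ν = 0`. For `ν = 0` the decrease
of `xᵀ P x` over an observability window is at least the observability Gramian evaluated at the
initial value (`HasLyapunovBounds.bform_add_hybridIntegral_le`), so `‖·‖_P` contracts by a factor
`ρ < 1` over each window, and a window of threshold `K` has hybrid length at most `K + 1`.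

For a perturbed solution `ζ`, the transition matrix gives the unperturbed solution `z` with the same
initial value. The difference `ζ - z` solves the perturbed system from `0`, so the growth bound
applies to it, and one window gives `‖ζ‖_P ↦ ρ ‖ζ‖_P + √p₂ (K + 1) sup |ν|`. Iteration yields
exponential decay plus a multiple of `sup |ν|`: uniform exponential stability is the case `ν = 0`,
and input-to-state stability is the general case. Neither variation of constants nor a Gronwall
estimate is needed, so measurability of `A`, `B` and `ν` plays no role.

The definition of a hybrid time domain constrains only the part below each of its points, so `D` may
branch: from some `(t, j)` both flow and jump may be possible within `D`. Then a window may leave the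
domain of the solution, and `Φ` may differ from `Q_d` at that jump. There is at most one such point
(`IsBranchPoint.unique`). Past it, `D` is totally ordered and the argument above applies; the hybrid
length of a solution before it is bounded, and there the growth bound suffices.
-/

noncomputable section

namespace HybridLTV

/-! ### Absolutely continuous functions -/

/-- Absolute continuity passes to a function whose increments are controlled by the increments of
two absolutely continuous functions. -/
lemma absolutelyContinuousOnInterval_of_dist_le {X Y Z : Type*} [PseudoMetricSpace X]
    [PseudoMetricSpace Y] [PseudoMetricSpace Z] {f : ℝ → X} {g : ℝ → Y} {h : ℝ → Z} {a b C C' : ℝ}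
    (hg : AbsolutelyContinuousOnInterval g a b) (hh : AbsolutelyContinuousOnInterval h a b)
    (hf : ∀ x ∈ uIcc a b, ∀ y ∈ uIcc a b,
      dist (f x) (f y) ≤ C * dist (g x) (g y) + C' * dist (h x) (h y)) :
    AbsolutelyContinuousOnInterval f a b := by
  unfold AbsolutelyContinuousOnInterval at *
  apply squeeze_zero' ?_ ?_ (by simpa using (hg.const_mul C).add (hh.const_mul C'))
  · exact Eventually.of_forall fun _ => Finset.sum_nonneg fun _ _ => dist_nonneg
  · rw [eventually_inf_principal]
    filter_upwards with E hE
    rw [Finset.mul_sum, Finset.mul_sum, ← Finset.sum_add_distrib]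
    exact Finset.sum_le_sum fun i hi => hf _ (hE.1 i hi).1 _ (hE.1 i hi).2

lemma absolutelyContinuousOnInterval_clm_comp {X Y : Type*}
    [NormedAddCommGroup X] [NormedSpace ℝ X] [NormedAddCommGroup Y] [NormedSpace ℝ Y]
    (L : X →L[ℝ] Y) {f : ℝ → X} {a b : ℝ} (hf : AbsolutelyContinuousOnInterval f a b) :
    AbsolutelyContinuousOnInterval (fun t => L (f t)) a b := by
  refine absolutelyContinuousOnInterval_of_dist_le (C := ‖L‖) (C' := 0) hf hf fun x _ y _ => ?_
  rw [dist_eq_norm, dist_eq_norm, ← map_sub]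
  simpa using L.le_opNorm (f x - f y)

lemma absolutelyContinuousOnInterval_bilinear_comp {X Y Z : Type*}
    [NormedAddCommGroup X] [NormedSpace ℝ X] [NormedAddCommGroup Y] [NormedSpace ℝ Y]
    [NormedAddCommGroup Z] [NormedSpace ℝ Z] {m : X × Y → Z} (hm : IsBoundedBilinearMap ℝ m)
    {f : ℝ → X} {g : ℝ → Y} {a b : ℝ} (hf : AbsolutelyContinuousOnInterval f a b)
    (hg : AbsolutelyContinuousOnInterval g a b) :
    AbsolutelyContinuousOnInterval (fun t => m (f t, g t)) a b := by
  obtain ⟨C, hC, hb⟩ := hm.bound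
  obtain ⟨Cf, hCf⟩ := hf.exists_bound
  obtain ⟨Cg, hCg⟩ := hg.exists_bound
  refine absolutelyContinuousOnInterval_of_dist_le (C := C * Cg) (C' := C * Cf) hf hg
    fun x hx y hy => ?_
  have h1 : m (f x, g x) - m (f y, g y) = m (f x - f y, g x) + m (f y, g x - g y) := by
    rw [hm.map_sub_left, hm.map_sub_right]; abel
  rw [dist_eq_norm, dist_eq_norm, dist_eq_norm, h1]
  refine (norm_add_le _ _).trans (add_le_add ?_ ?_)
  · calc _ ≤ C * ‖f x - f y‖ * ‖g x‖ := hb _ _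
      _ ≤ C * ‖f x - f y‖ * Cg := by gcongr; exact hCg x hx
      _ = _ := by ring
  · calc _ ≤ C * ‖f y‖ * ‖g x - g y‖ := hb _ _
      _ ≤ C * Cf * ‖g x - g y‖ := by gcongr; exact hCf y hy

/-- An upper bound on the derivative at almost every point integrates to a bound on the increment
of an absolutely continuous function. -/
lemma sub_le_integral_of_hasDerivAt_le {f φ : ℝ → ℝ} {a b : ℝ} (hab : a ≤ b)
    (hf : AbsolutelyContinuousOnInterval f a b) (hφ : IntervalIntegrable φ volume a b)
    (h : ∀ᵐ t : ℝ, t ∈ Ioo a b → ∃ d, HasDerivAt f d t ∧ d ≤ φ t) :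
    f b - f a ≤ ∫ t in a..b, φ t := by
  rw [← hf.integral_deriv_eq_sub]
  refine intervalIntegral.integral_mono_ae_restrict hab hf.intervalIntegrable_deriv hφ ?_
  rw [← Measure.restrict_congr_set Ioo_ae_eq_Icc, EventuallyLE, ae_restrict_iff' measurableSet_Ioo]
  filter_upwards [h] with t ht hm
  obtain ⟨d, hd, hle⟩ := ht hm
  rwa [hd.deriv]

lemma absolutelyContinuousOnInterval_sqrt_add {f : ℝ → ℝ} {a b ε : ℝ} (hε : 0 < ε)
    (hf : AbsolutelyContinuousOnInterval f a b) (h0 : ∀ t ∈ uIcc a b, 0 ≤ f t) :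
    AbsolutelyContinuousOnInterval (fun t => √(f t + ε)) a b := by
  refine absolutelyContinuousOnInterval_of_dist_le (C := 1 / √ε) (C' := 0) hf hf fun x hx y hy => ?_
  have hx0 := h0 x hx
  have hy0 := h0 y hy
  have hs : 0 < √ε := Real.sqrt_pos.2 hε
  have h1 : √ε ≤ √(f x + ε) := Real.sqrt_le_sqrt (by linarith)
  have h2 : f x - f y = (√(f x + ε) - √(f y + ε)) * (√(f x + ε) + √(f y + ε)) := by
    have e1 := Real.sq_sqrt (show 0 ≤ f x + ε by linarith)
    have e2 := Real.sq_sqrt (show 0 ≤ f y + ε by linarith)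
    linear_combination -e1 + e2
  rw [Real.dist_eq, Real.dist_eq, zero_mul, add_zero, one_div, ← div_eq_inv_mul, le_div_iff₀ hs, h2,
    abs_mul]
  gcongr
  exact (h1.trans (le_add_of_nonneg_right (Real.sqrt_nonneg _))).trans (le_abs_self _)

/-! ### Quadratic forms of matrices -/

variable {n : ℕ}

/-- The bilinear form `xᵀ M y` of a matrix. -/
def bform (M : Matrix (Fin n) (Fin n) ℝ) (x y : EuclideanSpace ℝ (Fin n)) : ℝ :=
  inner ℝ x (Matrix.toEuclideanCLM (𝕜 := ℝ) M y)

lemma bform_eq_dotProduct (M : Matrix (Fin n) (Fin n) ℝ) (x y : EuclideanSpace ℝ (Fin n)) :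
    bform M x y = x.ofLp ⬝ᵥ M *ᵥ y.ofLp :=
  Matrix.inner_toEuclideanCLM M x y

lemma bform_sub_matrix (M N : Matrix (Fin n) (Fin n) ℝ) (x y : EuclideanSpace ℝ (Fin n)) :
    bform (M - N) x y = bform M x y - bform N x y := by
  simp [bform, inner_sub_right]

lemma bform_neg_matrix (M : Matrix (Fin n) (Fin n) ℝ) (x y : EuclideanSpace ℝ (Fin n)) :
    bform (-M) x y = -bform M x y := by
  simp [bform]

lemma bform_smul_one (c : ℝ) (x : EuclideanSpace ℝ (Fin n)) :
    bform (c • (1 : Matrix (Fin n) (Fin n) ℝ)) x x = c * ‖x‖ ^ 2 := by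
  simp [bform, inner_smul_right]

lemma bform_mul (M N : Matrix (Fin n) (Fin n) ℝ) (x y : EuclideanSpace ℝ (Fin n)) :
    bform (M * N) x y = bform M x (Matrix.toEuclideanCLM (𝕜 := ℝ) N y) := by
  simp [bform]

lemma bform_transpose_mul (M N : Matrix (Fin n) (Fin n) ℝ) (x y : EuclideanSpace ℝ (Fin n)) :
    bform (Mᵀ * N) x y = bform N (Matrix.toEuclideanCLM (𝕜 := ℝ) M x) y := by
  rw [bform_eq_dotProduct, bform_eq_dotProduct, ← Matrix.mulVec_mulVec, Matrix.mulVec_transpose,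
    Matrix.ofLp_toEuclideanCLM, dotProduct_comm, ← Matrix.dotProduct_mulVec, dotProduct_comm]

lemma bform_symm {M : Matrix (Fin n) (Fin n) ℝ} (hM : M.IsSymm) (x y : EuclideanSpace ℝ (Fin n)) :
    bform M x y = bform M y x := by
  have h := bform_transpose_mul M 1 x y
  rw [mul_one, hM.eq] at h
  rw [h]
  simp only [bform, map_one, one_apply_eq_self]
  exact real_inner_comm _ _

lemma bform_nonneg {M : Matrix (Fin n) (Fin n) ℝ} (hM : M.PosSemidef)
    (x : EuclideanSpace ℝ (Fin n)) : 0 ≤ bform M x x := by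
  rw [bform_eq_dotProduct]
  simpa using hM.dotProduct_mulVec_nonneg x.ofLp

lemma bform_mono {M N : Matrix (Fin n) (Fin n) ℝ} (h : M ≤ N) (x : EuclideanSpace ℝ (Fin n)) :
    bform M x x ≤ bform N x x := by
  have := bform_nonneg (Matrix.le_iff.1 h) x
  rw [bform_sub_matrix] at this
  linarith

/-- The norm `√(xᵀ P x)` associated with a positive semidefinite matrix `P`. -/
def wnorm (P : Matrix (Fin n) (Fin n) ℝ) (x : EuclideanSpace ℝ (Fin n)) : ℝ := √(bform P x x)

lemma wnorm_nonneg (P : Matrix (Fin n) (Fin n) ℝ) (x : EuclideanSpace ℝ (Fin n)) :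
    0 ≤ wnorm P x := Real.sqrt_nonneg _

lemma wnorm_zero (P : Matrix (Fin n) (Fin n) ℝ) : wnorm P 0 = 0 := by simp [wnorm, bform]

/-- A positive semidefinite `P = Rᵀ R` gives `xᵀ P y = ⟪R x, R y⟫`, from which the triangle and
Cauchy–Schwarz inequalities for `P` are inherited. -/
lemma exists_bform_eq_inner {P : Matrix (Fin n) (Fin n) ℝ} (hP : P.PosSemidef) :
    ∃ S : EuclideanSpace ℝ (Fin n) →L[ℝ] EuclideanSpace ℝ (Fin n),
      (∀ x y, bform P x y = inner ℝ (S x) (S y)) ∧ ∀ x, wnorm P x = ‖S x‖ := by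
  obtain ⟨R, rfl⟩ := CStarAlgebra.nonneg_iff_eq_star_mul_self.mp hP.nonneg
  have h : ∀ x y, bform (star R * R) x y =
      inner ℝ (Matrix.toEuclideanCLM (𝕜 := ℝ) R x) (Matrix.toEuclideanCLM (𝕜 := ℝ) R y) :=
    fun x y => bform_transpose_mul R R x y
  refine ⟨Matrix.toEuclideanCLM (𝕜 := ℝ) R, h, fun x => ?_⟩
  rw [wnorm, h, real_inner_self_eq_norm_sq, Real.sqrt_sq (norm_nonneg _)]

lemma wnorm_add_le {P : Matrix (Fin n) (Fin n) ℝ} (hP : P.PosSemidef)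
    (x y : EuclideanSpace ℝ (Fin n)) : wnorm P (x + y) ≤ wnorm P x + wnorm P y := by
  obtain ⟨S, -, hS⟩ := exists_bform_eq_inner hP
  simpa only [hS, map_add] using norm_add_le (S x) (S y)

lemma bform_le_wnorm_mul {P : Matrix (Fin n) (Fin n) ℝ} (hP : P.PosSemidef)
    (x y : EuclideanSpace ℝ (Fin n)) : bform P x y ≤ wnorm P x * wnorm P y := by
  obtain ⟨S, h, hS⟩ := exists_bform_eq_inner hP
  simpa only [hS, h] using real_inner_le_norm (S x) (S y)

lemma posSemidef_of_smul_one_le {P : Matrix (Fin n) (Fin n) ℝ} {p : ℝ} (hp : 0 ≤ p)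
    (h : p • (1 : Matrix (Fin n) (Fin n) ℝ) ≤ P) : P.PosSemidef := by
  have h1 : (p • (1 : Matrix (Fin n) (Fin n) ℝ)).PosSemidef := Matrix.PosSemidef.one.smul hp
  simpa using h1.add (Matrix.le_iff.1 h)

lemma sqrt_mul_norm_le_wnorm {P : Matrix (Fin n) (Fin n) ℝ} {p : ℝ}
    (h : p • (1 : Matrix (Fin n) (Fin n) ℝ) ≤ P) (x : EuclideanSpace ℝ (Fin n)) :
    √p * ‖x‖ ≤ wnorm P x := by
  have h1 := bform_mono h x
  rw [bform_smul_one] at h1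
  rw [wnorm, ← Real.sqrt_sq (norm_nonneg x), ← Real.sqrt_mul' _ (sq_nonneg _)]
  exact Real.sqrt_le_sqrt h1

lemma wnorm_le_sqrt_mul_norm {P : Matrix (Fin n) (Fin n) ℝ} {p : ℝ}
    (h : P ≤ p • (1 : Matrix (Fin n) (Fin n) ℝ)) (x : EuclideanSpace ℝ (Fin n)) :
    wnorm P x ≤ √p * ‖x‖ := by
  have h1 := bform_mono h x
  rw [bform_smul_one] at h1
  rw [wnorm, ← Real.sqrt_sq (norm_nonneg x), ← Real.sqrt_mul' _ (sq_nonneg _)]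
  exact Real.sqrt_le_sqrt h1

/-- `Matrix.toEuclideanCLM` as a continuous linear map. -/
def euclideanCLM : Matrix (Fin n) (Fin n) ℝ →L[ℝ]
    (EuclideanSpace ℝ (Fin n) →L[ℝ] EuclideanSpace ℝ (Fin n)) :=
  LinearMap.toContinuousLinearMap
    { toFun := fun M => Matrix.toEuclideanCLM (𝕜 := ℝ) M
      map_add' := map_add _
      map_smul' := map_smul _ }

lemma euclideanCLM_apply (M : Matrix (Fin n) (Fin n) ℝ) :
    euclideanCLM M = Matrix.toEuclideanCLM (𝕜 := ℝ) M := rfl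

/-- Evaluation of a matrix at a fixed vector, as a continuous linear map of the matrix. -/
def mulVecCLM (v : EuclideanSpace ℝ (Fin n)) :
    Matrix (Fin n) (Fin n) ℝ →L[ℝ] EuclideanSpace ℝ (Fin n) :=
  euclideanCLM.flip v

lemma mulVecCLM_apply (v : EuclideanSpace ℝ (Fin n)) (M : Matrix (Fin n) (Fin n) ℝ) :
    mulVecCLM v M = Matrix.toEuclideanCLM (𝕜 := ℝ) M v := rfl

/-- The quadratic form at a fixed vector, as a continuous linear map of the matrix. -/
def bformCLM (v : EuclideanSpace ℝ (Fin n)) : Matrix (Fin n) (Fin n) ℝ →L[ℝ] ℝ :=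
  (innerSL ℝ v).comp (mulVecCLM v)

lemma bformCLM_apply (v : EuclideanSpace ℝ (Fin n)) (M : Matrix (Fin n) (Fin n) ℝ) :
    bformCLM v M = bform M v v := rfl

/-! ### The Lyapunov function along a flow -/

lemma absolutelyContinuousOnInterval_bform {P : ℝ → Matrix (Fin n) (Fin n) ℝ}
    {z : ℝ → EuclideanSpace ℝ (Fin n)} {a b : ℝ} (hP : AbsolutelyContinuousOnInterval P a b)
    (hz : AbsolutelyContinuousOnInterval z a b) :
    AbsolutelyContinuousOnInterval (fun t => bform (P t) (z t) (z t)) a b := by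
  have h1 := absolutelyContinuousOnInterval_clm_comp euclideanCLM hP
  have h2 := absolutelyContinuousOnInterval_bilinear_comp
    (m := fun p : (EuclideanSpace ℝ (Fin n) →L[ℝ] EuclideanSpace ℝ (Fin n)) ×
      EuclideanSpace ℝ (Fin n) => p.1 p.2) isBoundedBilinearMap_apply h1 hz
  exact absolutelyContinuousOnInterval_bilinear_comp
    (m := fun p : EuclideanSpace ℝ (Fin n) × EuclideanSpace ℝ (Fin n) => inner ℝ p.1 p.2)
    isBoundedBilinearMap_inner hz h2

/-- Along `z' = -A z + w`, the Lyapunov inequality for `P` bounds the derivative of `zᵀ P z`. -/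
lemma exists_hasDerivAt_bform_le {P : ℝ → Matrix (Fin n) (Fin n) ℝ}
    {z : ℝ → EuclideanSpace ℝ (Fin n)} {P' A Q : Matrix (Fin n) (Fin n) ℝ}
    {w : EuclideanSpace ℝ (Fin n)} {t : ℝ} (hs : (P t).IsSymm) (hP : HasDerivAt P P' t)
    (hz : HasDerivAt z (-(Matrix.toEuclideanCLM (𝕜 := ℝ) A (z t)) + w) t)
    (hle : P' - Aᵀ * P t - P t * A ≤ -Q) :
    ∃ d, HasDerivAt (fun s => bform (P s) (z s) (z s)) d t ∧
      d ≤ -bform Q (z t) (z t) + 2 * bform (P t) (z t) w := by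
  have h1 := (euclideanCLM.hasFDerivAt.comp_hasDerivAt t hP).clm_apply hz
  refine ⟨_, hz.inner ℝ h1, ?_⟩
  have h2 := bform_mono hle (z t)
  rw [bform_neg_matrix, bform_sub_matrix, bform_sub_matrix, bform_transpose_mul, bform_mul] at h2
  have e : inner ℝ (z t) (euclideanCLM P' (z t) +
        euclideanCLM (P t) (-(Matrix.toEuclideanCLM (𝕜 := ℝ) A (z t)) + w)) +
      inner ℝ (-(Matrix.toEuclideanCLM (𝕜 := ℝ) A (z t)) + w) (euclideanCLM (P t) (z t)) =
      bform P' (z t) (z t) - bform (P t) (z t) (Matrix.toEuclideanCLM (𝕜 := ℝ) A (z t))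
      - bform (P t) (Matrix.toEuclideanCLM (𝕜 := ℝ) A (z t)) (z t)
      + bform (P t) (z t) w + bform (P t) w (z t) := by
    simp only [bform, euclideanCLM_apply, inner_add_left, inner_add_right, map_add, map_neg,
      inner_neg_left, inner_neg_right]
    ring
  have e2 := bform_symm hs w (z t)
  refine (le_of_eq e).trans ?_
  linarith

/-- During flow the `P`-norm of a solution grows at most at the rate given by the perturbation. -/
lemma wnorm_flow_le {P A Q : ℝ → Matrix (Fin n) (Fin n) ℝ} {z w : ℝ → EuclideanSpace ℝ (Fin n)}
    {a b p N : ℝ} (hab : a ≤ b) (hPac : AbsolutelyContinuousOnInterval P a b)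
    (hzac : AbsolutelyContinuousOnInterval z a b) (hs : ∀ t ∈ Icc a b, (P t).IsSymm)
    (hpos : ∀ t ∈ Icc a b, (P t).PosSemidef)
    (hup : ∀ t ∈ Icc a b, P t ≤ p • (1 : Matrix (Fin n) (Fin n) ℝ))
    (hQ : ∀ t ∈ Icc a b, (Q t).PosSemidef)
    (hP : ∀ᵐ t : ℝ, t ∈ Ioo a b → ∃ P', HasDerivAt P P' t ∧
      P' - (A t)ᵀ * P t - P t * A t ≤ -Q t)
    (hz : ∀ᵐ t : ℝ, t ∈ Ioo a b →
      HasDerivAt z (-(Matrix.toEuclideanCLM (𝕜 := ℝ) (A t) (z t)) + w t) t)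
    (hw : ∀ t ∈ Ioo a b, ‖w t‖ ≤ N) :
    wnorm (P b) (z b) ≤ wnorm (P a) (z a) + √p * N * (b - a) := by
  have hV : ∀ t ∈ Icc a b, 0 ≤ bform (P t) (z t) (z t) := fun t ht => bform_nonneg (hpos t ht) _
  -- The square root is not differentiable at `0`: it is replaced by `√(· + ε)`, and `ε → 0`.
  have key : ∀ ε > 0, √(bform (P b) (z b) (z b) + ε) ≤
      √(bform (P a) (z a) (z a) + ε) + √p * N * (b - a) := by
    intro ε hε
    have hac := absolutelyContinuousOnInterval_sqrt_add hε
      (absolutelyContinuousOnInterval_bform hPac hzac) (by rwa [uIcc_of_le hab])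
    have := sub_le_integral_of_hasDerivAt_le (φ := fun _ => √p * N) hab hac (by simp) ?_
    · rw [intervalIntegral.integral_const, smul_eq_mul] at this
      linarith
    · filter_upwards [hP, hz] with t hPt hzt ht
      have htI := Ioo_subset_Icc_self ht
      obtain ⟨P', hP', hle⟩ := hPt ht
      obtain ⟨d, hd, hdle⟩ := exists_hasDerivAt_bform_le (hs t htI) hP' (hzt ht) hle
      have h0 := hV t htI
      have hpos' : 0 < √(bform (P t) (z t) (z t) + ε) := Real.sqrt_pos.2 (by linarith)
      refine ⟨_, (hd.add_const ε).sqrt (by linarith), ?_⟩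
      rw [div_le_iff₀ (by positivity)]
      have h1 := bform_le_wnorm_mul (hpos t htI) (z t) (w t)
      have h2 : wnorm (P t) (w t) ≤ √p * N :=
        (wnorm_le_sqrt_mul_norm (hup t htI) _).trans (by gcongr; exact hw t ht)
      have h3 : wnorm (P t) (z t) ≤ √(bform (P t) (z t) (z t) + ε) :=
        Real.sqrt_le_sqrt (by linarith)
      have h4 : wnorm (P t) (z t) * wnorm (P t) (w t) ≤
          √(bform (P t) (z t) (z t) + ε) * (√p * N) :=
        mul_le_mul h3 h2 (wnorm_nonneg _ _) hpos'.le
      have h5 := bform_nonneg (hQ t htI) (z t)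
      linarith
  have ht : ∀ c : ℝ, Tendsto (fun ε => √(c + ε)) (𝓝[>] 0) (𝓝 (√c)) := fun c => by
    have : Continuous fun ε : ℝ => √(c + ε) := by fun_prop
    simpa using (this.tendsto 0).mono_left nhdsWithin_le_nhds
  exact le_of_tendsto_of_tendsto (ht _) ((ht _).add_const _)
    (eventually_mem_nhdsWithin.mono fun ε hε => key ε hε)

/-- During unperturbed flow `zᵀ P z` decreases by at least the integral of `zᵀ Q z`. The matrices
`R t` represent `Q` in the initial value `v`. Where `R` is not integrable, its integral is `0` and
the claim is monotonicity. -/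
lemma bform_flow_le {P A Q R : ℝ → Matrix (Fin n) (Fin n) ℝ} {z : ℝ → EuclideanSpace ℝ (Fin n)}
    {v : EuclideanSpace ℝ (Fin n)}
    {a b : ℝ} (hab : a ≤ b) (hPac : AbsolutelyContinuousOnInterval P a b)
    (hzac : AbsolutelyContinuousOnInterval z a b) (hs : ∀ t ∈ Icc a b, (P t).IsSymm)
    (hQ : ∀ t ∈ Icc a b, (Q t).PosSemidef)
    (hP : ∀ᵐ t : ℝ, t ∈ Ioo a b → ∃ P', HasDerivAt P P' t ∧
      P' - (A t)ᵀ * P t - P t * A t ≤ -Q t)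
    (hz : ∀ᵐ t : ℝ, t ∈ Ioo a b →
      HasDerivAt z (-(Matrix.toEuclideanCLM (𝕜 := ℝ) (A t) (z t))) t)
    (hR : ∀ t ∈ Ioo a b, bform (R t) v v = bform (Q t) (z t) (z t)) :
    bform (P b) (z b) (z b) + bform (∫ t in a..b, R t) v v ≤ bform (P a) (z a) (z a) := by
  have hac := absolutelyContinuousOnInterval_bform hPac hzac
  have hder : ∀ᵐ t : ℝ, t ∈ Ioo a b → ∃ d, HasDerivAt (fun s => bform (P s) (z s) (z s)) d t ∧
      d ≤ -bform (Q t) (z t) (z t) := by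
    filter_upwards [hP, hz] with t hPt hzt ht
    obtain ⟨P', hP', hle⟩ := hPt ht
    obtain ⟨d, hd, hdle⟩ := exists_hasDerivAt_bform_le (w := 0) (hs t (Ioo_subset_Icc_self ht)) hP'
      (by simpa using hzt ht) hle
    exact ⟨d, hd, by simpa [bform] using hdle⟩
  by_cases hint : IntervalIntegrable R volume a b
  · have h1 := (bformCLM v).intervalIntegral_comp_comm hint
    have h2 : IntervalIntegrable (fun t => bformCLM v (R t)) volume a b :=
      ⟨(bformCLM v).integrable_comp hint.1, (bformCLM v).integrable_comp hint.2⟩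
    simp only [bformCLM_apply] at h1 h2
    have := sub_le_integral_of_hasDerivAt_le hab hac h2.neg (by
      filter_upwards [hder] with t ht hm
      obtain ⟨d, hd, hle⟩ := ht hm
      exact ⟨d, hd, by simpa [hR t hm] using hle⟩)
    simp only [Pi.neg_apply, intervalIntegral.integral_neg] at this
    linarith
  · rw [intervalIntegral.integral_undef hint]
    have := sub_le_integral_of_hasDerivAt_le (φ := fun _ => 0) hab hac (by simp) (by
      filter_upwards [hder] with t ht hm
      obtain ⟨d, hd, hle⟩ := ht hm
      exact ⟨d, hd, hle.trans (neg_nonpos.2 (bform_nonneg (hQ t (Ioo_subset_Icc_self hm)) _))⟩)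
    simp only [intervalIntegral.integral_zero] at this
    simp only [bform, map_zero, zero_apply, inner_zero_right, add_zero]
    simp only [bform] at this
    linarith

/-! ### Hybrid time domains -/

lemma le_of_step_le {τ : ℕ → ℝ} {j m a b : ℕ} (h : ∀ i ∈ Icc j m, τ i ≤ τ (i + 1)) (ha : j ≤ a)
    (hab : a ≤ b) (hb : b ≤ m + 1) : τ a ≤ τ b := by
  induction b, hab using Nat.le_induction with
  | base => exact le_rfl
  | succ k hk ih => exact (ih (by omega)).trans (h k ⟨by omega, by omega⟩)

lemma IsHybridTimeDomain.exists_chain {E : Set (ℝ × ℕ)} {t₀ T : ℝ} {j₀ J : ℕ}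
    (hE : IsHybridTimeDomain t₀ j₀ E) (h : (T, J) ∈ E) :
    ∃ τ : ℕ → ℝ, τ j₀ = t₀ ∧ τ (J + 1) = T ∧ j₀ ≤ J ∧ (∀ i ∈ Icc j₀ J, τ i ≤ τ (i + 1)) ∧
      chain τ j₀ J ⊆ E ∧ ∀ s i, (s, i) ∈ E → s ≤ T → i ≤ J → τ i ≤ s ∧ s ≤ τ (i + 1) := by
  obtain ⟨τ, h0, h1, hm, he⟩ := hE.2 T J h
  refine ⟨τ, h0, h1, (hE.1 h).2, hm, fun x hx => (he.symm ▸ hx : x ∈ E ∩ _).1,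
    fun s i hs hsT hiJ => ?_⟩
  have : (s, i) ∈ E ∩ (Icc t₀ T ×ˢ Icc j₀ J) :=
    ⟨hs, ⟨(hE.1 hs).1, hsT⟩, ⟨(hE.1 hs).2, hiJ⟩⟩
  rw [he] at this
  exact this.2.2

/-- The points of a hybrid time domain below a given one are totally ordered. -/
lemma IsHybridTimeDomain.le_of_lt {E : Set (ℝ × ℕ)} {t₀ T s s' : ℝ} {j₀ J i i' : ℕ}
    (hE : IsHybridTimeDomain t₀ j₀ E) (h : (T, J) ∈ E) (hs : (s, i) ∈ E) (hs' : (s', i') ∈ E)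
    (hsT : s ≤ T) (hsT' : s' ≤ T) (hi' : i' ≤ J) (hlt : i < i') : s ≤ s' := by
  obtain ⟨τ, -, -, -, hm, -, hall⟩ := hE.exists_chain h
  exact ((hall s i hs hsT (by omega)).2.trans
    (le_of_step_le hm ((hE.1 hs).2.trans (Nat.le_succ i)) hlt (by omega))).trans
    (hall s' i' hs' hsT' hi').1

lemma IsHybridTimeDomain.Icc_subset_slice {E : Set (ℝ × ℕ)} {t₀ a b : ℝ} {j₀ i : ℕ}
    (hE : IsHybridTimeDomain t₀ j₀ E) (ha : (a, i) ∈ E) (hb : (b, i) ∈ E) :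
    Icc a b ⊆ slice E i := by
  intro s hs
  obtain ⟨τ, -, hT, hJ, hm, hsub, hall⟩ := hE.exists_chain hb
  exact hsub ⟨hJ, le_rfl, (hall a i ha (hs.1.trans hs.2) le_rfl).1.trans hs.1, hs.2.trans hT.ge⟩

/-- A hybrid time domain inside another one contains all points of the latter between its initial
point and any of its points. -/
lemma IsHybridTimeDomain.mem_of_subset {D E : Set (ℝ × ℕ)} {d₀ t₀ T s : ℝ} {e₀ j₀ J i : ℕ}
    (hD : IsHybridTimeDomain d₀ e₀ D) (hE : IsHybridTimeDomain t₀ j₀ E) (hED : E ⊆ D)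
    (h : (T, J) ∈ E) (hs : (s, i) ∈ D) (hts : t₀ ≤ s) (hji : j₀ ≤ i) (hsT : s ≤ T) (hiJ : i ≤ J) :
    (s, i) ∈ E := by
  obtain ⟨τ, h0, hT, hJ, hm, hsub, hall⟩ := hE.exists_chain h
  refine hsub ⟨hji, hiJ, ?_, ?_⟩
  · rcases hji.eq_or_lt with rfl | hlt
    · exact h0.le.trans hts
    · obtain ⟨k, rfl⟩ : ∃ k, i = k + 1 := ⟨i - 1, by omega⟩
      exact hD.le_of_lt (hED h)
        (hED (hsub ⟨Nat.lt_succ_iff.1 hlt, by simpa using (Nat.le_succ k).trans hiJ,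
          hm k ⟨Nat.lt_succ_iff.1 hlt, (Nat.le_succ k).trans hiJ⟩, le_rfl⟩ : (τ (k + 1), k) ∈ E))
        hs ((le_of_step_le hm (by omega) (by omega) le_rfl).trans hT.le) hsT hiJ (Nat.lt_succ_self k)
  · rcases hiJ.eq_or_lt with rfl | hlt
    · exact hsT.trans hT.ge
    · exact hD.le_of_lt (hED h) hs
        (hED (hsub ⟨by simpa using hji.trans (Nat.le_succ i), hlt, le_rfl,
          hm (i + 1) ⟨by omega, hlt⟩⟩ : (τ (i + 1), i + 1) ∈ E))
        hsT ((le_of_step_le hm (by omega) (by omega) le_rfl).trans hT.le) hlt (Nat.lt_succ_self i)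

lemma IsHybridTimeDomain.forward {E : Set (ℝ × ℕ)} {t₀ t : ℝ} {j₀ j : ℕ}
    (hE : IsHybridTimeDomain t₀ j₀ E) (h : (t, j) ∈ E) :
    IsHybridTimeDomain t j (forward E t j) := by
  refine ⟨fun x hx => ⟨hx.2.1, hx.2.2⟩, fun T J hTJ => ?_⟩
  obtain ⟨τ, h0, hT, hJ, hm, hsub, hall⟩ := hE.exists_chain hTJ.1
  have htT : t ≤ T := hTJ.2.1
  have hjJ : j ≤ J := hTJ.2.2
  have hj := (hE.1 h).2
  have ht := hall t j h htT hjJ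
  refine ⟨fun i => if i = j then t else τ i, by simp, ?_, ?_, ?_⟩
  · simp only [show J + 1 ≠ j by omega, if_false, hT]
  · rintro i ⟨hi1, hi2⟩
    simp only [show i + 1 ≠ j by omega, if_false]
    split_ifs with hij
    · exact hij ▸ ht.2
    · exact hm i ⟨le_trans hj hi1, hi2⟩
  · ext ⟨s, i⟩
    simp only [HybridLTV.forward, chain, mem_inter_iff, mem_prod, mem_Icc, Set.mem_ofPred_eq]
    constructor
    · rintro ⟨⟨hs, hts, hji⟩, ⟨-, hsT⟩, -, hiJ⟩
      have := hall s i hs hsT hiJ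
      simp only [show i + 1 ≠ j by omega, if_false]
      refine ⟨hji, hiJ, ?_, this.2⟩
      split_ifs
      exacts [hts, this.1]
    · rintro ⟨hji, hiJ, h1, h2⟩
      simp only [show i + 1 ≠ j by omega, if_false] at h2
      have hsT : s ≤ T := (h2.trans (le_of_step_le hm (by have : j₀ ≤ j := hj; omega) (by omega)
        le_rfl)).trans hT.le
      split_ifs at h1 with hij
      · subst hij
        exact ⟨⟨hsub ⟨hj, hiJ, ht.1.trans h1, h2⟩, h1, hji⟩, ⟨h1, hsT⟩, hji, hiJ⟩
      · have hts : t ≤ s := (ht.2.trans (le_of_step_le hm (by have : j₀ ≤ j := hj; omega)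
          (by omega) (by omega))).trans h1
        exact ⟨⟨hsub ⟨le_trans hj hji, hiJ, h1, h2⟩, hts, hji⟩, ⟨hts, hsT⟩, hji, hiJ⟩

/-- Hybrid length `t + j` increases along a chain in steps of at most `1`. -/
lemma exists_mem_chain_length {τ : ℕ → ℝ} {j m : ℕ} {L : ℝ} (hjm : j ≤ m)
    (hm : ∀ i ∈ Icc j m, τ i ≤ τ (i + 1)) (h0 : τ j + j ≤ L) (h1 : L ≤ τ (m + 1) + m) :
    ∃ s i, (s, i) ∈ chain τ j m ∧ L ≤ s + i ∧ s + i ≤ L + 1 := by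
  induction m, hjm using Nat.le_induction with
  | base =>
    exact ⟨L - j, j, ⟨le_rfl, le_rfl, by simpa using by linarith, by simpa using by linarith⟩,
      by linarith, by linarith⟩
  | succ k hk ih =>
    have hmk : ∀ i ∈ Icc j k, τ i ≤ τ (i + 1) := fun i hi => hm i ⟨hi.1, hi.2.trans (Nat.le_succ k)⟩
    have hk1 := hm (k + 1) ⟨by omega, le_rfl⟩
    by_cases h : L ≤ τ (k + 1) + k
    · obtain ⟨s, i, hc, hl⟩ := ih hmk h
      exact ⟨s, i, ⟨hc.1, hc.2.1.trans (Nat.le_succ k), hc.2.2⟩, hl⟩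
    · push Not at h
      push_cast at h1
      by_cases h' : L ≤ τ (k + 1) + (k + 1)
      · exact ⟨τ (k + 1), k + 1, ⟨by simpa using by omega, le_rfl, le_rfl, hk1⟩,
          by push_cast; linarith, by push_cast; linarith⟩
      · refine ⟨L - (k + 1), k + 1, ⟨by simpa using by omega, le_rfl, ?_, ?_⟩, ?_, ?_⟩
        · simp only; linarith
        · simp only; linarith
        · push_cast; linarith
        · push_cast; linarith

/-- Bounds on the increments of `f` over the pieces of a chain add up. -/
lemma le_add_sum_of_chain {τ : ℕ → ℝ} {j m : ℕ} {f : ℝ → ℕ → ℝ} {a b : ℕ → ℝ} (hjm : j ≤ m)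
    (hflow : ∀ i ∈ Icc j m, f (τ (i + 1)) i ≤ f (τ i) i + a i)
    (hjump : ∀ i ∈ Ico j m, f (τ (i + 1)) (i + 1) ≤ f (τ (i + 1)) i + b i) :
    f (τ (m + 1)) m ≤ f (τ j) j + (∑ i ∈ Finset.Icc j m, a i + ∑ i ∈ Finset.Ico j m, b i) := by
  induction m, hjm using Nat.le_induction with
  | base => simpa using hflow j ⟨le_rfl, le_rfl⟩
  | succ k hk ih =>
    have h1 := ih (fun i hi => hflow i ⟨hi.1, hi.2.trans (Nat.le_succ k)⟩)
      (fun i hi => hjump i ⟨hi.1, hi.2.trans (Nat.lt_succ_self k)⟩)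
    have h2 := hjump k ⟨hk, Nat.lt_succ_self k⟩
    have h3 := hflow (k + 1) ⟨by omega, le_rfl⟩
    rw [Finset.sum_Icc_succ_top (by omega), Finset.sum_Ico_succ_top hk]
    linarith

lemma sum_chain_length {τ : ℕ → ℝ} {j m : ℕ} (hjm : j ≤ m) (c : ℝ) :
    (∑ i ∈ Finset.Icc j m, c * (τ (i + 1) - τ i)) + ∑ _i ∈ Finset.Ico j m, c =
      c * (τ (m + 1) + m - τ j - j) := by
  induction m, hjm using Nat.le_induction with
  | base => rw [Finset.Icc_self, Finset.sum_singleton, Finset.Ico_self, Finset.sum_empty]; ring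
  | succ k hk ih =>
    rw [Finset.sum_Icc_succ_top (by omega), Finset.sum_Ico_succ_top hk]
    push_cast
    linear_combination ih

/-- Hybrid length along a window passes through some value in `[K, K + 1]`, so the shortest hybrid
time domain of length at least `K` is no longer than that. -/
lemma IsWindow.length_le {D : Set (ℝ × ℕ)} {t K : ℝ} {j m : ℕ} {τ : ℕ → ℝ}
    (hw : IsWindow D t j K m τ) (hK : 0 < K) : (τ (m + 1) - t) + ((m : ℝ) - j) ≤ K + 1 := by
  have h := hw.length
  obtain ⟨s, i, hc, h1, h2⟩ := exists_mem_chain_length (L := t + j + K) hw.le hw.mono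
    (by rw [hw.start]; linarith) (by linarith)
  have hts : t ≤ s := hw.start ▸ (le_of_step_le hw.mono le_rfl hc.1
    (hc.2.1.trans (Nat.le_succ m))).trans hc.2.2.1
  have := hw.shortest s i (hw.sub hc) hts hc.1 (by linarith)
  linarith

/-! ### Branch points -/

/-- A point of `D` from which both flow and jump are possible within `D`. The definition of a
hybrid time domain constrains only the points below a given one, so it does not exclude this. -/
def IsBranchPoint (D : Set (ℝ × ℕ)) (t : ℝ) (j : ℕ) : Prop :=
  (t, j) ∈ D ∧ (t, j + 1) ∈ D ∧ ∃ t' > t, (t', j) ∈ D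

/-- No branch point of `D` lies at or after `(t, j)`. -/
def NoBranchAfter (D : Set (ℝ × ℕ)) (t : ℝ) (j : ℕ) : Prop :=
  ∀ s i, IsBranchPoint D s i → t ≤ s → ¬ j ≤ i

/-- A hybrid time domain has at most one branch point: the flow branch leaving it never jumps and
the jump branch never flows, as a point after both branches would have incomparable points of `D`
below it. -/
lemma IsBranchPoint.unique {D : Set (ℝ × ℕ)} {d₀ t t' : ℝ} {e₀ i i' : ℕ}
    (hD : IsHybridTimeDomain d₀ e₀ D) (h : IsBranchPoint D t i) (h' : IsBranchPoint D t' i') :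
    t = t' ∧ i = i' := by
  have same : ∀ {s s' : ℝ} {k : ℕ}, IsBranchPoint D s k → IsBranchPoint D s' k → s' ≤ s := by
    intro s s' k hs hs'
    by_contra! hlt
    exact hlt.not_ge (hD.le_of_lt hs'.2.1 hs'.1 hs.2.1 le_rfl hlt.le le_rfl (Nat.lt_succ_self k))
  have lower : ∀ {s s' : ℝ} {k k' : ℕ}, IsBranchPoint D s k → IsBranchPoint D s' k' → ¬ k < k' := by
    intro s s' k k' hs hs' hk
    obtain ⟨hs1, hs2, u, hu, hs3⟩ := hs
    obtain ⟨hs1', -, u', hu', hs3'⟩ := hs'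
    -- A point of `D` shortly after `(s, k)` on its flow branch, and `(s, k + 1)`, are incomparable
    -- and both below `(u', k')` if `s ≤ s'`. If `s' < s`, then `D` reaches level `k + 1` before
    -- time `s`, at a point incomparable with `(s, k)`, and both lie below `(s, k + 1)`.
    rcases le_or_gt s s' with hle | hlt
    · have hx : (min u u', k) ∈ D :=
        hD.Icc_subset_slice hs1 hs3 ⟨le_min hu.le (hle.trans hu'.le), min_le_left _ _⟩
      have := hD.le_of_lt hs3' hx hs2 (min_le_right _ _) (hle.trans hu'.le) hk (Nat.lt_succ_self k)
      exact (lt_min hu (hle.trans_lt hu')).not_ge this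
    · obtain ⟨τ, -, hT, -, hm, hsub, -⟩ := hD.exists_chain hs1'
      have he : e₀ ≤ k := (hD.1 hs1).2
      have hx : (τ (k + 1), k + 1) ∈ D :=
        hsub ⟨by simpa using by omega, hk, le_rfl, hm (k + 1) ⟨by omega, hk⟩⟩
      have hle : τ (k + 1) ≤ s' := (le_of_step_le hm (by omega) (by omega) le_rfl).trans hT.le
      have := hD.le_of_lt hs2 hs1 hx le_rfl (hle.trans hlt.le) le_rfl (Nat.lt_succ_self k)
      linarith
  rcases lt_trichotomy i i' with hlt | rfl | hlt
  · exact absurd hlt (lower h h')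
  · exact ⟨le_antisymm (same h' h) (same h h'), rfl⟩
  · exact absurd hlt (lower h' h)

/-- Beyond a finite hybrid length there are no branch points. -/
lemma IsHybridTimeDomain.exists_noBranchAfter {D : Set (ℝ × ℕ)} {d₀ : ℝ} {e₀ : ℕ}
    (hD : IsHybridTimeDomain d₀ e₀ D) :
    ∃ L : ℝ, ∀ (t : ℝ) (j : ℕ), L < t + j → NoBranchAfter D t j := by
  by_cases h : ∃ s i, IsBranchPoint D s i
  · obtain ⟨s, i, hb⟩ := h
    refine ⟨s + i, fun t j hL s' i' hb' ht hj => ?_⟩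
    obtain ⟨rfl, rfl⟩ := hb.unique hD hb'
    have : (j : ℝ) ≤ i := by exact_mod_cast hj
    linarith
  · push Not at h
    exact ⟨0, fun t j _ s i hb => absurd hb (h s i)⟩

lemma NoBranchAfter.mono {D : Set (ℝ × ℕ)} {t s : ℝ} {j i : ℕ} (h : NoBranchAfter D t j)
    (hts : t ≤ s) (hji : j ≤ i) : NoBranchAfter D s i :=
  fun s' i' hb hs hi => h s' i' hb (hts.trans hs) (hji.trans hi)

/-- If `(T', J')` had a lower level but a later time than `(T, J)`, the last point of level `J'` below
`(T, J)` would be a branch point. -/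
lemma NoBranchAfter.le_time {D : Set (ℝ × ℕ)} {d₀ t T T' : ℝ} {e₀ j J J' : ℕ}
    (hD : IsHybridTimeDomain d₀ e₀ D) (h : NoBranchAfter D t j) (hp : (t, j) ∈ D)
    (hq : (T, J) ∈ D) (htT : t ≤ T) (hw : (T', J') ∈ D) (hjJ' : j ≤ J') (hlt : J' < J) :
    T' ≤ T := by
  by_contra! hT
  have hq' : (T, J) ∈ forward D t j := ⟨hq, htT, hjJ'.trans hlt.le⟩
  obtain ⟨τ, h0, hT1, -, hm, hsub, -⟩ := (hD.forward hp).exists_chain hq'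
  have h1 : (τ (J' + 1), J') ∈ forward D t j :=
    hsub ⟨hjJ', hlt.le, hm J' ⟨hjJ', hlt.le⟩, le_rfl⟩
  have h2 : (τ (J' + 1), J' + 1) ∈ forward D t j :=
    hsub ⟨by simpa using by omega, hlt, le_rfl, hm (J' + 1) ⟨by omega, hlt⟩⟩
  have h3 : τ (J' + 1) ≤ T := (le_of_step_le hm (by omega) (by omega) le_rfl).trans hT1.le
  exact h _ _ ⟨h1.1, h2.1, T', h3.trans_lt hT, hw⟩ h1.2.1 hjJ'

/-- Past the branch points, hybrid length decides which of two points comes first. -/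
lemma NoBranchAfter.le_of_length_lt {D : Set (ℝ × ℕ)} {d₀ t T T' : ℝ} {e₀ j J J' : ℕ}
    (hD : IsHybridTimeDomain d₀ e₀ D) (h : NoBranchAfter D t j) (hp : (t, j) ∈ D)
    (hq : (T, J) ∈ D) (htT : t ≤ T) (hjJ : j ≤ J) (hw : (T', J') ∈ D) (htT' : t ≤ T')
    (hjJ' : j ≤ J') (hlen : T' + J' < T + J) : T' ≤ T ∧ J' ≤ J := by
  rcases lt_trichotomy J' J with hlt | rfl | hlt
  · exact ⟨h.le_time hD hp hq htT hw hjJ' hlt, hlt.le⟩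
  · exact ⟨by linarith, le_rfl⟩
  · have h1 := h.le_time hD hp hw htT' hq hjJ hlt
    have : (J : ℝ) < J' := by exact_mod_cast hlt
    linarith

/-- At jumps past the branch points, `Φ` takes the value `Q_d`. -/
lemma NoBranchAfter.notMem_interior_slice {D : Set (ℝ × ℕ)} {t s : ℝ} {j i : ℕ}
    (h : NoBranchAfter D t j) (hts : t ≤ s) (hji : j ≤ i) (h1 : (s, i) ∈ D)
    (h2 : (s, i + 1) ∈ D) : s ∉ interior (slice D i) := by
  intro hs
  obtain ⟨ε, hε, hball⟩ := Metric.isOpen_iff.1 isOpen_interior s hs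
  have : s + ε / 2 ∈ slice D i := interior_subset (hball (by
    rw [Metric.mem_ball, Real.dist_eq, add_sub_cancel_left, abs_of_pos (half_pos hε)]
    exact half_lt_self hε))
  exact h s i ⟨h1, h2, s + ε / 2, by linarith, this⟩ hts hji

/-! ### Solutions of the linear hybrid system -/

lemma IsSolution.restrict {X : Type*} [NormedAddCommGroup X] [NormedSpace ℝ X]
    {D E E' : Set (ℝ × ℕ)} {F G : X → ℝ → ℕ → X} {t₀ t₁ : ℝ} {j₀ j₁ : ℕ} {ζ : ℝ → ℕ → X}
    (h : IsSolution D F G t₀ j₀ E ζ) (hE' : IsHybridTimeDomain t₁ j₁ E') (hsub : E' ⊆ E)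
    (hstart : (t₁, j₁) ∈ E') : IsSolution D F G t₁ j₁ E' ζ where
  dom := hE'
  sub := hsub.trans h.sub
  start := hstart
  arc := fun j a b hab hI => h.arc j a b hab (hI.trans fun _ hs => hsub hs)
  flow := fun j => (h.flow j).mono fun _ ht hi => ht
    (interior_mono (show slice E' j ⊆ slice E j from fun _ hs => hsub hs) hi)
  jump := fun t j h1 h2 => h.jump t j (hsub h1) (hsub h2)

lemma IsLinearSolution.forward {D E : Set (ℝ × ℕ)} {A B : ℝ → ℕ → Matrix (Fin n) (Fin n) ℝ}
    {ν ζ : ℝ → ℕ → EuclideanSpace ℝ (Fin n)} {t₀ t : ℝ} {j₀ j : ℕ}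
    (h : IsLinearSolution D A B ν t₀ j₀ E ζ) (hp : (t, j) ∈ E) :
    IsLinearSolution D A B ν t j (forward E t j) ζ :=
  IsSolution.restrict h (h.dom.forward hp) (fun _ hx => hx.1) ⟨hp, le_rfl, le_rfl⟩

lemma IsLinearSolution.sub {D E : Set (ℝ × ℕ)} {A B : ℝ → ℕ → Matrix (Fin n) (Fin n) ℝ}
    {ν ζ z : ℝ → ℕ → EuclideanSpace ℝ (Fin n)} {t₀ : ℝ} {j₀ : ℕ}
    (h : IsLinearSolution D A B ν t₀ j₀ E ζ)
    (hz : IsLinearSolution D A B (fun _ _ => 0) t₀ j₀ E z) :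
    IsLinearSolution D A B ν t₀ j₀ E (fun t j => ζ t j - z t j) where
  dom := h.dom
  sub := IsSolution.sub h
  start := h.start
  arc := fun j a b hab hI => (h.arc j a b hab hI).sub (hz.arc j a b hab hI)
  flow := fun j => by
    filter_upwards [h.flow j, hz.flow j] with t h1 h2 ht
    convert! (h1 ht).sub (h2 ht) using 1
    simp only [flowMap, map_sub]
    abel
  jump := fun t j h1 h2 => by
    rw [h.jump t j h1 h2, hz.jump t j h1 h2]
    simp only [jumpMap, map_sub]
    abel

lemma IsTransitionMatrix.isLinearSolution {D : Set (ℝ × ℕ)}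
    {A B M : ℝ → ℕ → Matrix (Fin n) (Fin n) ℝ} {t₀ : ℝ} {j₀ : ℕ}
    (h : IsTransitionMatrix D A B t₀ j₀ M) (v : EuclideanSpace ℝ (Fin n)) :
    IsLinearSolution D A B (fun _ _ => 0) t₀ j₀ (HybridLTV.forward D t₀ j₀)
      (fun t j => Matrix.toEuclideanCLM (𝕜 := ℝ) (M t j) v) where
  dom := h.1.dom
  sub := h.1.sub
  start := h.1.start
  arc := fun j a b hab hI => by
    have := absolutelyContinuousOnInterval_clm_comp (mulVecCLM v)
      (h.1.arc j a b hab hI)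
    simpa only [mulVecCLM_apply] using this
  flow := fun j => by
    filter_upwards [h.1.flow j] with t h1 ht
    have := (mulVecCLM v).hasFDerivAt.comp_hasDerivAt t (h1 ht)
    simp only [Function.comp_def, mulVecCLM_apply, map_neg, map_mul,
      mul_apply_eq_comp] at this
    simpa only [flowMap, add_zero] using this
  jump := fun t j h1 h2 => by
    rw [h.1.jump t j h1 h2]
    simp only [jumpMap, map_mul, mul_apply_eq_comp, add_zero]

/-! ### Growth and decrease of the Lyapunov function -/

/-- The Lyapunov inequalities with named bounds `p₁ I ≤ P ≤ p₂ I`. -/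
structure HasLyapunovBounds (D : Set (ℝ × ℕ)) (A B P Qc Qd : ℝ → ℕ → Matrix (Fin n) (Fin n) ℝ)
    (p₁ p₂ : ℝ) : Prop where
  arc : IsHybridArc D P
  symm : ∀ t j, (t, j) ∈ D → (P t j).IsSymm
  pos₁ : 0 < p₁
  pos₂ : 0 < p₂
  lower : ∀ t j, (t, j) ∈ D → p₁ • (1 : Matrix (Fin n) (Fin n) ℝ) ≤ P t j
  upper : ∀ t j, (t, j) ∈ D → P t j ≤ p₂ • (1 : Matrix (Fin n) (Fin n) ℝ)
  posc : ∀ t j, (t, j) ∈ D → (Qc t j).PosSemidef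
  posd : ∀ t j, (t, j) ∈ D → (Qd t j).PosSemidef
  flow : ∀ j, ∀ᵐ t : ℝ, t ∈ interior (slice D j) →
    ∃ P' : Matrix (Fin n) (Fin n) ℝ, HasDerivAt (fun s => P s j) P' t ∧
      P' - (A t j)ᵀ * P t j - P t j * A t j ≤ -Qc t j
  jump : ∀ t j, (t, j) ∈ D → (t, j + 1) ∈ D →
    (1 - B t j)ᵀ * P t (j + 1) * (1 - B t j) - P t j ≤ -Qd t j

lemma LyapunovInequalities.exists_hasLyapunovBounds {D : Set (ℝ × ℕ)}
    {A B P Qc Qd : ℝ → ℕ → Matrix (Fin n) (Fin n) ℝ}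
    (h : LyapunovInequalities D A B P Qc Qd) :
    ∃ p₁ p₂, HasLyapunovBounds D A B P Qc Qd p₁ p₂ := by
  obtain ⟨h1, h2, ⟨p₁, p₂, hp1, hp2, h3⟩, h4, h5, h6⟩ := h
  exact ⟨p₁, p₂, h1, h2, hp1, hp2, fun t j ht => (h3 t j ht).1, fun t j ht => (h3 t j ht).2,
    fun t j ht => (h4 t j ht).1, fun t j ht => (h4 t j ht).2, h5, h6⟩

section Lyapunov

variable {D : Set (ℝ × ℕ)} {A B P Qc Qd : ℝ → ℕ → Matrix (Fin n) (Fin n) ℝ} {p₁ p₂ : ℝ}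

lemma HasLyapunovBounds.posSemidef (h : HasLyapunovBounds D A B P Qc Qd p₁ p₂) {t : ℝ} {j : ℕ}
    (ht : (t, j) ∈ D) : (P t j).PosSemidef :=
  posSemidef_of_smul_one_le h.pos₁.le (h.lower t j ht)

lemma HasLyapunovBounds.bform_jump_le (h : HasLyapunovBounds D A B P Qc Qd p₁ p₂) {t : ℝ} {j : ℕ}
    (h1 : (t, j) ∈ D) (h2 : (t, j + 1) ∈ D) (x : EuclideanSpace ℝ (Fin n)) :
    bform (P t (j + 1)) (Matrix.toEuclideanCLM (𝕜 := ℝ) (1 - B t j) x)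
      (Matrix.toEuclideanCLM (𝕜 := ℝ) (1 - B t j) x) ≤ bform (P t j) x x + -bform (Qd t j) x x := by
  have := bform_mono (h.jump t j h1 h2) x
  rw [bform_sub_matrix, bform_neg_matrix, bform_mul, bform_transpose_mul] at this
  linarith

lemma Ioo_subset_interior_slice {E : Set (ℝ × ℕ)} {a b : ℝ} {i : ℕ} (h : Icc a b ⊆ slice E i) :
    Ioo a b ⊆ interior (slice E i) :=
  interior_maximal (Ioo_subset_Icc_self.trans h) isOpen_Ioo

lemma Icc_subset_slice_of_chain {E : Set (ℝ × ℕ)} {τ : ℕ → ℝ} {j m i : ℕ} (h : chain τ j m ⊆ E)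
    (hi : i ∈ Icc j m) : Icc (τ i) (τ (i + 1)) ⊆ slice E i :=
  fun _ hs => h ⟨hi.1, hi.2, hs.1, hs.2⟩

/-- The `P`-norm of any solution grows at most linearly in the size of the perturbation and the
elapsed hybrid length; in particular it never grows when there is no perturbation. -/
lemma HasLyapunovBounds.wnorm_le (h : HasLyapunovBounds D A B P Qc Qd p₁ p₂)
    {ν ζ : ℝ → ℕ → EuclideanSpace ℝ (Fin n)} {E : Set (ℝ × ℕ)} {t₀ t N : ℝ} {j₀ j : ℕ}
    (hζ : IsLinearSolution D A B ν t₀ j₀ E ζ) (ht : (t, j) ∈ E)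
    (hν : ∀ x ∈ E \ HybridLTV.forward E t j, ‖ν x.1 x.2‖ ≤ N) :
    wnorm (P t j) (ζ t j) ≤ wnorm (P t₀ j₀) (ζ t₀ j₀) + √p₂ * N * (t + j - t₀ - j₀) := by
  obtain ⟨τ, h0, hT, hJ, hm, hsub, -⟩ := hζ.dom.exists_chain ht
  have hsubD := hsub.trans (IsSolution.sub hζ)
  have key := le_add_sum_of_chain (τ := τ) (f := fun t j => wnorm (P t j) (ζ t j))
    (a := fun i => √p₂ * N * (τ (i + 1) - τ i)) (b := fun _ => √p₂ * N) hJ ?_ ?_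
  · rwa [sum_chain_length hJ, hT, h0] at key
  · intro i hi
    have hI := Icc_subset_slice_of_chain hsub hi
    have hID := Icc_subset_slice_of_chain hsubD hi
    refine wnorm_flow_le (A := fun t => A t i) (Q := fun t => Qc t i) (w := fun t => ν t i)
      (P := fun t => P t i) (z := fun t => ζ t i) (hm i hi)
      (h.arc i _ _ (hm i hi) hID) (hζ.arc i _ _ (hm i hi) hI) (fun s hs => h.symm s i (hID hs))
      (fun s hs => h.posSemidef (hID hs)) (fun s hs => h.upper s i (hID hs))
      (fun s hs => h.posc s i (hID hs)) ?_ ?_ ?_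
    · filter_upwards [h.flow i] with s hs hsI
      exact hs (Ioo_subset_interior_slice hID hsI)
    · filter_upwards [hζ.flow i] with s hs hsI
      exact hs (Ioo_subset_interior_slice hI hsI)
    · intro s hs
      refine hν (s, i) ⟨hI (Ioo_subset_Icc_self hs), fun hf => ?_⟩
      have hji : j = i := le_antisymm hf.2.2 hi.2
      have : t ≤ s := hf.2.1
      rw [← hT, hji] at this
      exact this.not_gt hs.2
  · intro i hi
    have h1 : (τ (i + 1), i) ∈ E := hsub ⟨hi.1, hi.2.le, hm i ⟨hi.1, hi.2.le⟩, le_rfl⟩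
    have h2 : (τ (i + 1), i + 1) ∈ E := hsub ⟨hi.1.trans (Nat.le_succ i), hi.2, le_rfl,
      hm (i + 1) ⟨hi.1.trans (Nat.le_succ i), hi.2⟩⟩
    have h1D := IsSolution.sub hζ h1
    have h2D := IsSolution.sub hζ h2
    have hpos := h.posSemidef h2D
    rw [hζ.jump _ _ h1 h2]
    refine (wnorm_add_le hpos _ _).trans (add_le_add ?_ ?_)
    · refine Real.sqrt_le_sqrt ((h.bform_jump_le h1D h2D _).trans ?_)
      linarith [bform_nonneg (h.posd _ _ h1D) (ζ (τ (i + 1)) i)]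
    · refine (wnorm_le_sqrt_mul_norm (h.upper _ _ h2D) _).trans ?_
      gcongr
      exact hν (τ (i + 1), i) ⟨h1, fun hf => absurd hi.2 (not_lt.2 hf.2.2)⟩

/-- Along a chain past the branch points, the Lyapunov function of an unperturbed solution
decreases by at least the hybrid integral of its observability Gramian. -/
lemma HasLyapunovBounds.bform_add_hybridIntegral_le (h : HasLyapunovBounds D A B P Qc Qd p₁ p₂)
    {M : ℝ → ℕ → Matrix (Fin n) (Fin n) ℝ} {t₀ : ℝ} {j₀ m : ℕ} {τ : ℕ → ℝ}
    (hM : IsTransitionMatrix D A B t₀ j₀ M) (hnb : NoBranchAfter D t₀ j₀) (h0 : τ j₀ = t₀)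
    (hJ : j₀ ≤ m) (hm : ∀ i ∈ Icc j₀ m, τ i ≤ τ (i + 1)) (hsub : chain τ j₀ m ⊆ D)
    (v : EuclideanSpace ℝ (Fin n)) :
    bform (P (τ (m + 1)) m) (Matrix.toEuclideanCLM (𝕜 := ℝ) (M (τ (m + 1)) m) v)
        (Matrix.toEuclideanCLM (𝕜 := ℝ) (M (τ (m + 1)) m) v) +
      bform (hybridIntegral τ j₀ m (fun s i => (M s i)ᵀ * Phi D Qc Qd s i * M s i)) v v ≤
    bform (P t₀ j₀) v v := by
  have hz := hM.isLinearSolution v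
  have hge : ∀ i ∈ Icc j₀ (m + 1), t₀ ≤ τ i := fun i hi => h0 ▸ le_of_step_le hm le_rfl hi.1 hi.2
  have hsubF : chain τ j₀ m ⊆ HybridLTV.forward D t₀ j₀ := fun x hx =>
    ⟨hsub hx, (hge x.2 ⟨hx.1, hx.2.1.trans (Nat.le_succ m)⟩).trans hx.2.2.1, hx.1⟩
  have hbf : ∀ s i, bform ((M s i)ᵀ * Phi D Qc Qd s i * M s i) v v =
      bform (Phi D Qc Qd s i) (Matrix.toEuclideanCLM (𝕜 := ℝ) (M s i) v)
        (Matrix.toEuclideanCLM (𝕜 := ℝ) (M s i) v) := fun s i => by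
    rw [bform_mul, bform_transpose_mul]
  have hint : bform (hybridIntegral τ j₀ m (fun s i => (M s i)ᵀ * Phi D Qc Qd s i * M s i)) v v =
      (∑ i ∈ Finset.Icc j₀ m,
        bform (∫ s in (τ i)..(τ (i + 1)), (M s i)ᵀ * Phi D Qc Qd s i * M s i) v v) +
      ∑ i ∈ Finset.Ico j₀ m, bform ((M (τ (i + 1)) i)ᵀ * Phi D Qc Qd (τ (i + 1)) i *
        M (τ (i + 1)) i) v v := by
    simp only [← bformCLM_apply, hybridIntegral, map_add, map_sum]
  have key := le_add_sum_of_chain (τ := τ)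
    (f := fun t j => bform (P t j) (Matrix.toEuclideanCLM (𝕜 := ℝ) (M t j) v)
      (Matrix.toEuclideanCLM (𝕜 := ℝ) (M t j) v))
    (a := fun i => -bform (∫ s in (τ i)..(τ (i + 1)), (M s i)ᵀ * Phi D Qc Qd s i * M s i) v v)
    (b := fun i => -bform ((M (τ (i + 1)) i)ᵀ * Phi D Qc Qd (τ (i + 1)) i * M (τ (i + 1)) i) v v)
    hJ ?_ ?_
  · rw [Finset.sum_neg_distrib, Finset.sum_neg_distrib] at key
    have e : Matrix.toEuclideanCLM (𝕜 := ℝ) (M (τ j₀) j₀) v = v := by rw [h0, hM.2]; simp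
    rw [e, h0] at key
    rw [hint]
    linarith
  · intro i hi
    have hI := Icc_subset_slice_of_chain hsubF hi
    have hID := Icc_subset_slice_of_chain hsub hi
    have := bform_flow_le (A := fun t => A t i) (Q := fun t => Qc t i)
      (R := fun s => (M s i)ᵀ * Phi D Qc Qd s i * M s i) (v := v)
      (P := fun t => P t i) (z := fun t => Matrix.toEuclideanCLM (𝕜 := ℝ) (M t i) v) (hm i hi)
      (h.arc i _ _ (hm i hi) hID) (hz.arc i _ _ (hm i hi) hI) (fun s hs => h.symm s i (hID hs))
      (fun s hs => h.posc s i (hID hs)) ?_ ?_ ?_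
    · linarith
    · filter_upwards [h.flow i] with s hs hsI
      exact hs (Ioo_subset_interior_slice hID hsI)
    · filter_upwards [hz.flow i] with s hs hsI
      simpa [flowMap] using hs (Ioo_subset_interior_slice hI hsI)
    · intro s hs
      rw [hbf, Phi, if_pos (Ioo_subset_interior_slice hID hs)]
  · intro i hi
    have h1 : (τ (i + 1), i) ∈ HybridLTV.forward D t₀ j₀ :=
      hsubF ⟨hi.1, hi.2.le, hm i ⟨hi.1, hi.2.le⟩, le_rfl⟩
    have h2 : (τ (i + 1), i + 1) ∈ HybridLTV.forward D t₀ j₀ :=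
      hsubF ⟨hi.1.trans (Nat.le_succ i), hi.2, le_rfl,
        hm (i + 1) ⟨hi.1.trans (Nat.le_succ i), hi.2⟩⟩
    have := h.bform_jump_le h1.1 h2.1 (Matrix.toEuclideanCLM (𝕜 := ℝ) (M (τ (i + 1)) i) v)
    have hj := hz.jump _ _ h1 h2
    simp only [jumpMap, add_zero] at hj
    rw [hj, hbf, Phi, if_neg (hnb.notMem_interior_slice h1.2.1 h1.2.2 h1.1 h2.1)]
    exact this

/-! ### Contraction over observability windows -/

/-- From every point of `D` past the branch points, some point of `D` is reached after a hybrid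
length between `K` and `K + 1` at which every unperturbed solution has contracted, in the `P`-norm,
by the factor `ρ`. -/
def ContractsOverWindows (D : Set (ℝ × ℕ)) (A B P : ℝ → ℕ → Matrix (Fin n) (Fin n) ℝ)
    (ρ K : ℝ) : Prop :=
  ∀ t₀ j₀, (t₀, j₀) ∈ D → NoBranchAfter D t₀ j₀ →
    ∃ s i, (s, i) ∈ D ∧ t₀ ≤ s ∧ j₀ ≤ i ∧ K ≤ s + i - t₀ - j₀ ∧ s + i - t₀ - j₀ ≤ K + 1 ∧
      ∃ M, IsTransitionMatrix D A B t₀ j₀ M ∧ ∀ v,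
        wnorm (P s i) (Matrix.toEuclideanCLM (𝕜 := ℝ) (M s i) v) ≤ ρ * wnorm (P t₀ j₀) v

/-- In positive dimension the observability inequality can hold only if the transition matrix
exists: `transitionMatrix` is `0` otherwise. -/
lemma isTransitionMatrix_of_le_hybridIntegral (hn : 0 < n) {t₀ μ : ℝ} {j₀ m : ℕ} {τ : ℕ → ℝ}
    {Φ : ℝ → ℕ → Matrix (Fin n) (Fin n) ℝ} (hμ : 0 < μ)
    (h : μ • (1 : Matrix (Fin n) (Fin n) ℝ) ≤ hybridIntegral τ j₀ m (fun s i =>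
      (transitionMatrix D A B t₀ j₀ s i)ᵀ * Φ s i * transitionMatrix D A B t₀ j₀ s i)) :
    IsTransitionMatrix D A B t₀ j₀ (transitionMatrix D A B t₀ j₀) := by
  by_cases hex : ∃ M, IsTransitionMatrix D A B t₀ j₀ M
  · rw [transitionMatrix, dif_pos hex]
    exact hex.choose_spec
  · rw [transitionMatrix, dif_neg hex] at h
    have h0 : hybridIntegral τ j₀ m (fun s i => ((0 : ℝ → ℕ → Matrix (Fin n) (Fin n) ℝ) s i)ᵀ *
        Φ s i * (0 : ℝ → ℕ → Matrix (Fin n) (Fin n) ℝ) s i) = 0 := by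
      simp [hybridIntegral]
    rw [h0] at h
    have := bform_mono h (EuclideanSpace.single ⟨0, hn⟩ 1)
    rw [bform_smul_one] at this
    simp [bform] at this
    linarith

lemma HasLyapunovBounds.exists_contraction (hn : 0 < n)
    (h : HasLyapunovBounds D A B P Qc Qd p₁ p₂) (hobs : HUO D A B Qc Qd) :
    ∃ ρ K : ℝ, 0 < ρ ∧ ρ < 1 ∧ 0 < K ∧ ContractsOverWindows D A B P ρ K := by
  obtain ⟨K, μ, hK, hμ, hwin⟩ := hobs
  -- The factor `1 - μ / p₂` may fail to be positive; `1 / 2` replaces it then.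
  set θ := max (1 - μ / p₂) (1 / 2) with hθ
  have hθ0 : 0 < θ := lt_max_of_lt_right (by norm_num)
  have hθ1 : θ < 1 := max_lt (by linarith [div_pos hμ h.pos₂]) (by norm_num)
  refine ⟨√θ, K, Real.sqrt_pos.2 hθ0, (Real.sqrt_lt' one_pos).2 (by simpa using hθ1), hK,
    fun t₀ j₀ hp hnb => ?_⟩
  obtain ⟨m, τ, hw, hle⟩ := hwin t₀ j₀ hp
  have hM := isTransitionMatrix_of_le_hybridIntegral hn hμ hle
  have h1 := hw.length
  have h2 := hw.length_le hK
  refine ⟨τ (m + 1), m, hw.sub ⟨hw.le, le_rfl, hw.mono m ⟨hw.le, le_rfl⟩, le_rfl⟩,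
    hw.start ▸ le_of_step_le hw.mono le_rfl (hw.le.trans (Nat.le_succ m)) le_rfl, hw.le,
    by linarith, by linarith, _, hM, fun v => ?_⟩
  have h3 := h.bform_add_hybridIntegral_le hM hnb hw.start hw.le hw.mono hw.sub v
  have h4 := bform_mono hle v
  rw [bform_smul_one] at h4
  have h5 := bform_mono (h.upper _ _ hp) v
  rw [bform_smul_one] at h5
  have h6 : μ / p₂ * bform (P t₀ j₀) v v ≤ μ * ‖v‖ ^ 2 := by
    calc _ ≤ μ / p₂ * (p₂ * ‖v‖ ^ 2) := by gcongr; exact (div_pos hμ h.pos₂).le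
      _ = _ := by field_simp [h.pos₂.ne']
  have h7 : (1 - μ / p₂) * bform (P t₀ j₀) v v ≤ θ * bform (P t₀ j₀) v v := by
    gcongr
    · exact bform_nonneg (h.posSemidef hp) v
    · exact le_max_left _ _
  rw [wnorm, wnorm, ← Real.sqrt_mul hθ0.le]
  refine Real.sqrt_le_sqrt ?_
  linarith

/-- The contraction of unperturbed solutions, transferred to perturbed ones: the difference of the
two starts at `0`, so it stays below the growth bound. -/
lemma HasLyapunovBounds.exists_wnorm_le_of_contraction {d₀ : ℝ} {e₀ : ℕ}
    (hD : IsHybridTimeDomain d₀ e₀ D) (h : HasLyapunovBounds D A B P Qc Qd p₁ p₂) {ρ K : ℝ}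
    (hcon : ContractsOverWindows D A B P ρ K)
    {ν ζ : ℝ → ℕ → EuclideanSpace ℝ (Fin n)} {E : Set (ℝ × ℕ)} {t₀ t N : ℝ} {j₀ j : ℕ}
    (hζ : IsLinearSolution D A B ν t₀ j₀ E ζ) (ht : (t, j) ∈ E) (hnb : NoBranchAfter D t₀ j₀)
    (hN : 0 ≤ N) (hν : ∀ x ∈ E \ HybridLTV.forward E t j, ‖ν x.1 x.2‖ ≤ N)
    (hlen : K + 1 < t + j - t₀ - j₀) :
    ∃ s i, (s, i) ∈ E ∧ s ≤ t ∧ i ≤ j ∧ K ≤ s + i - t₀ - j₀ ∧ s + i - t₀ - j₀ ≤ K + 1 ∧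
      wnorm (P s i) (ζ s i) ≤ ρ * wnorm (P t₀ j₀) (ζ t₀ j₀) + √p₂ * N * (K + 1) := by
  have hp := IsSolution.sub hζ hζ.start
  obtain ⟨s, i, hw, hts, hji, hK, hK1, M, hM, hle⟩ := hcon t₀ j₀ hp hnb
  have htD := hζ.dom.1 ht
  obtain ⟨hst, hij⟩ := hnb.le_of_length_lt hD hp (IsSolution.sub hζ ht) htD.1 htD.2 hw hts hji
    (by linarith)
  have hwE := hD.mem_of_subset hζ.dom (IsSolution.sub hζ) ht hw hts hji hst hij
  refine ⟨s, i, hwE, hst, hij, hK, hK1, ?_⟩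
  have hz : IsLinearSolution D A B (fun _ _ => 0) t₀ j₀ E
      (fun t j => Matrix.toEuclideanCLM (𝕜 := ℝ) (M t j) (ζ t₀ j₀)) :=
    IsSolution.restrict (hM.isLinearSolution (ζ t₀ j₀)) hζ.dom
      (fun x hx => ⟨IsSolution.sub hζ hx, (hζ.dom.1 hx).1, (hζ.dom.1 hx).2⟩) hζ.start
  have he := h.wnorm_le (hζ.sub hz) hwE (N := N) fun x hx => hν x ⟨hx.1, fun hf =>
    hx.2 ⟨hx.1, hst.trans hf.2.1, hij.trans hf.2.2⟩⟩
  have h0 : ζ t₀ j₀ - Matrix.toEuclideanCLM (𝕜 := ℝ) (M t₀ j₀) (ζ t₀ j₀) = 0 := by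
    rw [hM.2]; simp
  rw [h0, wnorm_zero, zero_add] at he
  have h1 := wnorm_add_le (h.posSemidef hw)
    (Matrix.toEuclideanCLM (𝕜 := ℝ) (M s i) (ζ t₀ j₀))
    (ζ s i - Matrix.toEuclideanCLM (𝕜 := ℝ) (M s i) (ζ t₀ j₀))
  rw [add_sub_cancel] at h1
  have h2 : √p₂ * N * (s + i - t₀ - j₀) ≤ √p₂ * N * (K + 1) := by gcongr
  linarith [hle (ζ t₀ j₀)]

/-- Iterating the contraction gives exponential decay, up to a term proportional to the
perturbation, for solutions that start past the branch points. -/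
lemma HasLyapunovBounds.wnorm_le_exp_of_noBranchAfter {d₀ : ℝ} {e₀ : ℕ}
    (hD : IsHybridTimeDomain d₀ e₀ D) (h : HasLyapunovBounds D A B P Qc Qd p₁ p₂) {ρ K lam : ℝ}
    (hρ0 : 0 < ρ) (hρ1 : ρ < 1) (hK : 0 < K) (hlam : 0 < lam)
    (hρ : Real.exp (-lam * (K + 1)) = ρ)
    (hcon : ContractsOverWindows D A B P ρ K)
    {ν ζ : ℝ → ℕ → EuclideanSpace ℝ (Fin n)} {E : Set (ℝ × ℕ)} {t₀ t N : ℝ} {j₀ j : ℕ}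
    (hζ : IsLinearSolution D A B ν t₀ j₀ E ζ) (ht : (t, j) ∈ E) (hnb : NoBranchAfter D t₀ j₀)
    (hN : 0 ≤ N) (hν : ∀ x ∈ E \ HybridLTV.forward E t j, ‖ν x.1 x.2‖ ≤ N) :
    wnorm (P t j) (ζ t j) ≤
      ρ⁻¹ * Real.exp (-lam * (t + j - t₀ - j₀)) * wnorm (P t₀ j₀) (ζ t₀ j₀) +
        √p₂ * (K + 1) * (1 / (1 - ρ) + 1) * N := by
  set G := √p₂ * N * (K + 1) with hG
  have hG0 : 0 ≤ G := by positivity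
  -- `c` is the fixed point of `x ↦ ρ x + G`; the excess of the `P`-norm over it is contracted.
  set c := G / (1 - ρ) with hc
  have hc0 : 0 ≤ c := div_nonneg hG0 (by linarith)
  have hcG : c = ρ * c + G := by
    have : c * (1 - ρ) = G := div_mul_cancel₀ _ (by linarith)
    linarith
  have base : ∀ {E : Set (ℝ × ℕ)} {t₀ : ℝ} {j₀ : ℕ}, IsLinearSolution D A B ν t₀ j₀ E ζ →
      (t, j) ∈ E → (∀ x ∈ E \ HybridLTV.forward E t j, ‖ν x.1 x.2‖ ≤ N) →
      t + j - t₀ - j₀ ≤ K + 1 →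
      wnorm (P t j) (ζ t j) ≤ ρ⁻¹ * Real.exp (-lam * (t + j - t₀ - j₀)) *
        max (wnorm (P t₀ j₀) (ζ t₀ j₀) - c) 0 + (c + G) := by
    intro E t₀ j₀ hζ ht hν hk
    have h1 := h.wnorm_le hζ ht hν
    have h2 : √p₂ * N * (t + j - t₀ - j₀) ≤ G := by rw [hG]; gcongr
    have hge : 1 ≤ ρ⁻¹ * Real.exp (-lam * (t + j - t₀ - j₀)) := by
      rw [← div_eq_inv_mul, one_le_div hρ0, ← hρ]
      exact Real.exp_le_exp.2 (by nlinarith)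
    have h3 := le_mul_of_one_le_left (le_max_right (wnorm (P t₀ j₀) (ζ t₀ j₀) - c) 0) hge
    have h4 := le_max_left (wnorm (P t₀ j₀) (ζ t₀ j₀) - c) 0
    linarith
  have key : ∀ (k : ℕ) {E : Set (ℝ × ℕ)} {t₀ : ℝ} {j₀ : ℕ}, IsLinearSolution D A B ν t₀ j₀ E ζ →
      (t, j) ∈ E → NoBranchAfter D t₀ j₀ →
      (∀ x ∈ E \ HybridLTV.forward E t j, ‖ν x.1 x.2‖ ≤ N) → t + j - t₀ - j₀ ≤ k * K →
      wnorm (P t j) (ζ t j) ≤ ρ⁻¹ * Real.exp (-lam * (t + j - t₀ - j₀)) *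
        max (wnorm (P t₀ j₀) (ζ t₀ j₀) - c) 0 + (c + G) := by
    intro k
    induction k with
    | zero =>
      intro E t₀ j₀ hζ ht hnb hν hk
      rw [Nat.cast_zero, zero_mul] at hk
      exact base hζ ht hν (by linarith)
    | succ k ih =>
      intro E t₀ j₀ hζ ht hnb hν hk
      rcases le_or_gt (t + j - t₀ - j₀) (K + 1) with hlen | hlen
      · exact base hζ ht hν hlen
      obtain ⟨s, i, hw, hst, hij, hsK, hsK1, hle⟩ :=
        h.exists_wnorm_le_of_contraction hD hcon hζ ht hnb hN hν hlen
      push_cast at hk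
      have h1 := ih (hζ.forward hw) ⟨ht, hst, hij⟩
        (hnb.mono (hζ.dom.1 hw).1 (hζ.dom.1 hw).2)
        (fun x hx => hν x ⟨hx.1.1, fun hf => hx.2 ⟨hx.1, hf.2⟩⟩) (by linarith)
      have h2 : max (wnorm (P s i) (ζ s i) - c) 0 ≤
          ρ * max (wnorm (P t₀ j₀) (ζ t₀ j₀) - c) 0 := by
        refine max_le ?_ (mul_nonneg hρ0.le (le_max_right _ _))
        have := mul_le_mul_of_nonneg_left
          (le_max_left (wnorm (P t₀ j₀) (ζ t₀ j₀) - c) 0) hρ0.le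
        linarith
      have h3 : Real.exp (-lam * (t + j - s - i)) * ρ ≤
          Real.exp (-lam * (t + j - t₀ - j₀)) := by
        rw [← hρ, ← Real.exp_add]
        exact Real.exp_le_exp.2 (by nlinarith)
      refine h1.trans (add_le_add ?_ le_rfl)
      calc _ ≤ ρ⁻¹ * Real.exp (-lam * (t + j - s - i)) *
            (ρ * max (wnorm (P t₀ j₀) (ζ t₀ j₀) - c) 0) := by gcongr
        _ = ρ⁻¹ * (Real.exp (-lam * (t + j - s - i)) * ρ) *
            max (wnorm (P t₀ j₀) (ζ t₀ j₀) - c) 0 := by ring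
        _ ≤ _ := by gcongr
  obtain ⟨k, hk⟩ := exists_nat_ge ((t + j - t₀ - j₀) / K)
  have h1 := key k hζ ht hnb hν ((div_le_iff₀ hK).1 hk)
  have h2 : max (wnorm (P t₀ j₀) (ζ t₀ j₀) - c) 0 ≤ wnorm (P t₀ j₀) (ζ t₀ j₀) :=
    max_le (by linarith) (wnorm_nonneg _ _)
  refine h1.trans (add_le_add (by gcongr) (le_of_eq ?_))
  rw [hc, hG]
  ring

/-- The estimate behind both stability claims. Before the last branch point, where the
contraction is not available, the elapsed hybrid length is bounded and the growth bound suffices. -/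
lemma HasLyapunovBounds.exists_wnorm_le_exp {e₀ : ℕ} (hn : 0 < n)
    (hD : IsHybridTimeDomain 0 e₀ D) (h : HasLyapunovBounds D A B P Qc Qd p₁ p₂)
    (hobs : HUO D A B Qc Qd) :
    ∃ κ lam C : ℝ, 0 < κ ∧ 0 < lam ∧ 0 < C ∧
      ∀ (ν ζ : ℝ → ℕ → EuclideanSpace ℝ (Fin n)) (E : Set (ℝ × ℕ)) (t₀ : ℝ) (j₀ : ℕ),
      IsLinearSolution D A B ν t₀ j₀ E ζ → ∀ (t : ℝ) (j : ℕ), (t, j) ∈ E → ∀ N : ℝ, 0 ≤ N →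
      (∀ x ∈ E \ HybridLTV.forward E t j, ‖ν x.1 x.2‖ ≤ N) →
      wnorm (P t j) (ζ t j) ≤
        κ * Real.exp (-lam * (t + j - t₀ - j₀)) * wnorm (P t₀ j₀) (ζ t₀ j₀) + C * N := by
  obtain ⟨ρ, K, hρ0, hρ1, hK, hcon⟩ := h.exists_contraction hn hobs
  obtain ⟨L₀, hL₀⟩ := hD.exists_noBranchAfter
  -- `L ≥ 0` bounds the hybrid length `t + j` of the points that still have a branch point ahead.
  set L := max L₀ 0 with hLdef
  have hL0 : 0 ≤ L := le_max_right _ _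
  have hL : ∀ (t : ℝ) (j : ℕ), L < t + j → NoBranchAfter D t j :=
    fun t j ht => hL₀ t j ((le_max_left _ _).trans_lt ht)
  have hlog : Real.log ρ < 0 := Real.log_neg hρ0 hρ1
  set lam := -Real.log ρ / (K + 1) with hlam
  have hlam0 : 0 < lam := div_pos (by linarith) (by linarith)
  have hρ : Real.exp (-lam * (K + 1)) = ρ := by
    rw [hlam, neg_mul, div_mul_cancel₀ _ (by linarith : K + 1 ≠ 0), neg_neg, Real.exp_log hρ0]
  have hp : 0 < √p₂ := Real.sqrt_pos.2 h.pos₂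
  set C₁ := √p₂ * (K + 1) * (1 / (1 - ρ) + 1) with hC₁
  have hC₁0 : 0 < C₁ := by
    have : 0 < 1 / (1 - ρ) := div_pos one_pos (by linarith)
    positivity
  have hρi : 1 ≤ ρ⁻¹ := (one_le_inv₀ hρ0).2 hρ1.le
  refine ⟨ρ⁻¹ * Real.exp (lam * (L + 2)), lam, ρ⁻¹ * (√p₂ * (L + 2)) + C₁, by positivity, hlam0,
    by positivity, fun ν ζ E t₀ j₀ hζ t j ht N hN hν => ?_⟩
  set W := wnorm (P t₀ j₀) (ζ t₀ j₀)
  have hW : 0 ≤ W := wnorm_nonneg _ _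
  have hj₀ : (0 : ℝ) ≤ j₀ := Nat.cast_nonneg _
  have ht₀ : 0 ≤ t₀ := (hD.1 (IsSolution.sub hζ hζ.start)).1
  have hLN : 0 ≤ √p₂ * (L + 2) * N := by positivity
  have hexp : ∀ x, Real.exp (lam * (L + 2)) * Real.exp (-lam * x) =
      Real.exp (-lam * (x - (L + 2))) := fun x => by rw [← Real.exp_add]; ring_nf
  rw [mul_assoc ρ⁻¹, hexp]
  rcases le_or_gt (t + j) (L + 2) with hs | hs
  · have h1 := h.wnorm_le hζ ht hν
    have h2 : √p₂ * N * (t + j - t₀ - j₀) ≤ √p₂ * N * (L + 2) := by gcongr; linarith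
    have h3 : 1 ≤ ρ⁻¹ * Real.exp (-lam * (t + j - t₀ - j₀ - (L + 2))) :=
      one_le_mul_of_one_le_of_one_le hρi (Real.one_le_exp (by nlinarith))
    have h4 := le_mul_of_one_le_left hW h3
    have h5 := le_mul_of_one_le_left hLN hρi
    have h6 : 0 ≤ C₁ * N := by positivity
    calc _ ≤ W + √p₂ * (L + 2) * N := by linarith
      _ ≤ _ := by linarith
  rcases lt_or_ge L (t₀ + j₀) with hs₀ | hs₀
  · have h1 := h.wnorm_le_exp_of_noBranchAfter hD hρ0 hρ1 hK hlam0 hρ hcon hζ ht (hL _ _ hs₀) hN hν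
    refine h1.trans (add_le_add ?_ ?_)
    · gcongr ρ⁻¹ * ?_ * W
      exact Real.exp_le_exp.2 (by nlinarith)
    · gcongr
      exact le_add_of_nonneg_left (by positivity)
  · -- The solution is split at a point of hybrid length between `L + 1` and `L + 2`.
    obtain ⟨τ, h0, hT, hJ, hm, hsub, -⟩ := hζ.dom.exists_chain ht
    obtain ⟨s, i, hc, hs1, hs2⟩ := exists_mem_chain_length (L := L + 1) hJ hm
      (by rw [h0]; linarith) (by rw [hT]; linarith)
    have hw := hsub hc
    have hij : i ≤ j := hc.2.1
    have hst : s ≤ t := hc.2.2.2.trans ((le_of_step_le hm (hc.1.trans (Nat.le_succ i))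
      (Nat.succ_le_succ hij) le_rfl).trans hT.le)
    have h1 := h.wnorm_le_exp_of_noBranchAfter hD hρ0 hρ1 hK hlam0 hρ hcon (hζ.forward hw)
      ⟨ht, hst, hij⟩ (hL _ _ (by linarith)) hN
      (fun x hx => hν x ⟨hx.1.1, fun hf => hx.2 ⟨hx.1, hf.2⟩⟩)
    have h2 := h.wnorm_le hζ hw (N := N) fun x hx => hν x ⟨hx.1, fun hf =>
      hx.2 ⟨hx.1, hst.trans hf.2.1, hij.trans hf.2.2⟩⟩
    have h3 : √p₂ * N * (s + i - t₀ - j₀) ≤ √p₂ * (L + 2) * N := by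
      calc _ ≤ √p₂ * N * (L + 2) := by gcongr; linarith
        _ = _ := by ring
    have h4 : Real.exp (-lam * (t + j - s - i)) ≤
        Real.exp (-lam * (t + j - t₀ - j₀ - (L + 2))) := Real.exp_le_exp.2 (by nlinarith)
    have hij' : (i : ℝ) ≤ j := by exact_mod_cast hij
    have h5 : Real.exp (-lam * (t + j - s - i)) ≤ 1 := Real.exp_le_one_iff.2 (by nlinarith)
    calc _ ≤ ρ⁻¹ * Real.exp (-lam * (t + j - s - i)) * (W + √p₂ * (L + 2) * N) + C₁ * N := by
          refine h1.trans ?_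
          gcongr
          linarith
      _ = ρ⁻¹ * Real.exp (-lam * (t + j - s - i)) * W +
          ρ⁻¹ * Real.exp (-lam * (t + j - s - i)) * (√p₂ * (L + 2) * N) + C₁ * N := by ring
      _ ≤ ρ⁻¹ * Real.exp (-lam * (t + j - t₀ - j₀ - (L + 2))) * W +
          ρ⁻¹ * 1 * (√p₂ * (L + 2) * N) + C₁ * N := by gcongr
      _ = _ := by ring

/-! ### Stability -/

/-- Exponential decay up to a term proportional to the size of the past perturbation, in the
Euclidean norm and in every dimension. -/
lemma HasLyapunovBounds.exists_norm_le_exp {e₀ : ℕ}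
    (hD : IsHybridTimeDomain 0 e₀ D) (h : HasLyapunovBounds D A B P Qc Qd p₁ p₂)
    (hobs : HUO D A B Qc Qd) :
    ∃ κ lam C : ℝ, 0 < κ ∧ 0 < lam ∧ 0 < C ∧
      ∀ (ν ζ : ℝ → ℕ → EuclideanSpace ℝ (Fin n)) (E : Set (ℝ × ℕ)) (t₀ : ℝ) (j₀ : ℕ),
      IsLinearSolution D A B ν t₀ j₀ E ζ → ∀ (t : ℝ) (j : ℕ), (t, j) ∈ E → ∀ N : ℝ, 0 ≤ N →
      (∀ x ∈ E \ HybridLTV.forward E t j, ‖ν x.1 x.2‖ ≤ N) →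
      ‖ζ t j‖ ≤ κ * ‖ζ t₀ j₀‖ * Real.exp (-lam * (t + j - t₀ - j₀)) + C * N := by
  rcases Nat.eq_zero_or_pos n with rfl | hn
  -- In dimension `0` observability says nothing, but every solution is `0`.
  · refine ⟨1, 1, 1, one_pos, one_pos, one_pos, fun ν ζ E t₀ j₀ hζ t j ht N hN hν => ?_⟩
    rw [Subsingleton.elim (ζ t j) 0, norm_zero]
    positivity
  obtain ⟨κ, lam, C, hκ, hlam, hC, hmain⟩ := h.exists_wnorm_le_exp hn hD hobs
  have hp1 : 0 < √p₁ := Real.sqrt_pos.2 h.pos₁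
  have hp2 : 0 < √p₂ := Real.sqrt_pos.2 h.pos₂
  refine ⟨κ * √p₂ / √p₁, lam, C / √p₁, by positivity, hlam, by positivity,
    fun ν ζ E t₀ j₀ hζ t j ht N hN hν => ?_⟩
  have h1 := sqrt_mul_norm_le_wnorm (h.lower _ _ (IsSolution.sub hζ ht)) (ζ t j)
  have h2 := wnorm_le_sqrt_mul_norm (h.upper _ _ (IsSolution.sub hζ hζ.start)) (ζ t₀ j₀)
  have h3 := hmain ν ζ E t₀ j₀ hζ t j ht N hN hν
  have h4 : √p₁ * ‖ζ t j‖ ≤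
      κ * Real.exp (-lam * (t + j - t₀ - j₀)) * (√p₂ * ‖ζ t₀ j₀‖) + C * N :=
    h1.trans (h3.trans (by gcongr))
  have h5 := (le_div_iff₀' hp1).2 h4
  refine h5.trans (le_of_eq ?_)
  ring

end Lyapunov

lemma isClassKInfty_const_mul {c : ℝ} (hc : 0 < c) : IsClassKInfty fun r => c * r :=
  ⟨⟨by fun_prop, fun _ _ _ _ hab => mul_lt_mul_of_pos_left hab hc, mul_zero c⟩,
    tendsto_id.const_mul_atTop hc⟩

lemma isClassKL_exp {κ lam : ℝ} (hκ : 0 < κ) (hlam : 0 < lam) :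
    IsClassKL fun r s => κ * r * Real.exp (-lam * s) := by
  refine ⟨by fun_prop, fun s _ => ⟨by fun_prop, fun a _ b _ hab => ?_, by simp⟩,
    fun r hr => ⟨fun a _ b _ hab => ?_, ?_⟩⟩
  · have := Real.exp_pos (-lam * s)
    simp only
    gcongr
  · simp only
    gcongr ?_ * ?_
    exact Real.exp_le_exp.2 (by nlinarith)
  · have h1 : Tendsto (fun s : ℝ => -lam * s) atTop atBot :=
      tendsto_id.const_mul_atTop_of_neg (by linarith)
    simpa using (Real.tendsto_exp_atBot.comp h1).const_mul (κ * r)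

end HybridLTV

end

theorem mainTheorem3 (n : ℕ) (D : Set (ℝ × ℕ)) (hD : HybridLTV.IsHybridTimeDomain 0 0 D)
    (A B P Qc Qd : ℝ → ℕ → Matrix (Fin n) (Fin n) ℝ)
    (hLyap : HybridLTV.LyapunovInequalities D A B P Qc Qd)
    (hBdd : HybridLTV.UniformlyBounded D A B)
    (hHUO : HybridLTV.HUO D A B Qc Qd) :
    HybridLTV.UES D A B ∧ HybridLTV.ISS D A B := by
  obtain ⟨p₁, p₂, h⟩ := hLyap.exists_hasLyapunovBounds
  obtain ⟨κ, lam, C, hκ, hlam, hC, hmain⟩ := h.exists_norm_le_exp hD hHUO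
  refine ⟨⟨κ, lam, hκ, hlam, fun t₀ j₀ E ζ hζ t j ht => ?_⟩,
    fun r => C * r, fun r s => κ * r * Real.exp (-lam * s),
    HybridLTV.isClassKInfty_const_mul hC, HybridLTV.isClassKL_exp hκ hlam,
    fun ν t₀ j₀ E ζ hζ t j ht hbdd => ?_⟩
  · simpa using hmain _ ζ E t₀ j₀ hζ t j ht 0 le_rfl (by simp)
  · refine hmain ν ζ E t₀ j₀ hζ t j ht _ (Real.sSup_nonneg ?_) fun x hx =>
      le_csSup hbdd ⟨x, hx, rfl⟩
    rintro _ ⟨x, -, rfl⟩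
    exact norm_nonneg _
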